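/- Let $n$ be a positive integer and $p$ a real number with $2\le p<n$. Let $a_i\ge 0$ and $y_i\in\mathbb{R}^n$ for $i=1,2,\dots$, and let $K:\mathbb{R}^n\to\mathbb{R}$ be an arbitrary concave function. Define $$W(x)=\sum_{i=1}^\infty \frac{a_i}{|x-y_i|^{\frac{n-p}{p-1}}}+K(x),\qquad x\in\mathbb{R}^n,$$ where the series takes values in $[0,\infty]$, and the $i$-th term at $x=y_i$ is $\infty$ if $a_i>0$ and $0$ if $a_i=0$. If the series converges (to a finite value) at some point of $\mathbb{R}^n$, then $W$ is $p$-superharmonic in $\mathbb{R}^n$. Here, for an open set $D\subset\mathbb{R}^n$, a continuous function $h\in W^{1,p}_{\mathrm{loc}}(D)$ is called $p$-harmonic in $D$ if $\int_D|\nabla h|^{p-2}\,\nabla h\cdot\nabla\phi\,dx=0$ for every $\phi\in C_0^\infty(D)$. A function $u:\mathbb{R}^n\to(-\infty,\infty]$ is called $p$-superharmonic in $\mathbb{R}^n$ if (i) $u\not\equiv\infty$; (ii) $u$ is lower semicontinuous; and (iii) whenever $D\subset\mathbb{R}^n$ is a bounded open set and $h\in C(\overline{D})$ is $p$-harmonic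 in $D$ with $h\le u$ on $\partial D$, then $h\le u$ in $D$. -/

import Mathlib

open MeasureTheory
open scoped ENNReal ContDiff

/-- `φ ∈ C₀^∞(Ω)`: a smooth real function with compact support contained in `Ω`. -/
def IsTestFunction {n : ℕ} (Ω : Set (EuclideanSpace ℝ (Fin n)))
    (φ : EuclideanSpace ℝ (Fin n) → ℝ) : Prop :=
  ContDiff ℝ ∞ φ ∧ HasCompactSupport φ ∧ tsupport φ ⊆ Ω

/-- `f ∈ L^p_loc(Ω)`: `f` is in `L^p` on every compact subset of `Ω`. -/
def MemLpLoc {n : ℕ} {F : Type*} [NormedAddCommGroup F] (p : ℝ)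
    (Ω : Set (EuclideanSpace ℝ (Fin n))) (f : EuclideanSpace ℝ (Fin n) → F) : Prop :=
  ∀ C ⊆ Ω, IsCompact C → MemLp f (ENNReal.ofReal p) (volume.restrict C)

/-- `G` is a weak gradient of `h` on `Ω`: for every direction `v` and every test function `φ`,
`∫ h ∂ᵥφ = - ∫ φ ⟨G, v⟩`. -/
def IsWeakGradient {n : ℕ} (Ω : Set (EuclideanSpace ℝ (Fin n)))
    (h : EuclideanSpace ℝ (Fin n) → ℝ)
    (G : EuclideanSpace ℝ (Fin n) → EuclideanSpace ℝ (Fin n)) : Prop :=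
  ∀ φ : EuclideanSpace ℝ (Fin n) → ℝ, IsTestFunction Ω φ → ∀ v : EuclideanSpace ℝ (Fin n),
    ∫ x in Ω, h x * fderiv ℝ φ x v = - ∫ x in Ω, φ x * inner ℝ (G x) v

/-- A continuous `h ∈ W^{1,p}_loc(Ω)` is `p`-harmonic in `Ω` if
`∫ |∇h|^{p-2} ∇h · ∇φ = 0` for every `φ ∈ C₀^∞(Ω)`. The function `G` is the weak gradient `∇h`
(unique up to null sets), and `fderiv ℝ φ x (G x)` is `∇φ(x) · ∇h(x)`. -/
def IsPHarmonic {n : ℕ} (p : ℝ) (Ω : Set (EuclideanSpace ℝ (Fin n)))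
    (h : EuclideanSpace ℝ (Fin n) → ℝ) : Prop :=
  ContinuousOn h Ω ∧ MemLpLoc p Ω h ∧
    ∃ G : EuclideanSpace ℝ (Fin n) → EuclideanSpace ℝ (Fin n),
      MemLpLoc p Ω G ∧ IsWeakGradient Ω h G ∧
      ∀ φ : EuclideanSpace ℝ (Fin n) → ℝ, IsTestFunction Ω φ →
        ∫ x in Ω, ‖G x‖ ^ (p - 2) * fderiv ℝ φ x (G x) = 0

/-- `u : Ω → (-∞, ∞]` is `p`-superharmonic in the open set `Ω`: it is not identically `∞`, it is
lower semicontinuous, and it obeys the comparison principle with respect to `p`-harmonic functions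
on open sets `D` that are compactly contained in `Ω`. -/
structure IsPSuperharmonic {n : ℕ} (p : ℝ) (Ω : Set (EuclideanSpace ℝ (Fin n)))
    (u : EuclideanSpace ℝ (Fin n) → EReal) : Prop where
  ne_bot : ∀ x ∈ Ω, u x ≠ ⊥
  not_top : ∃ x ∈ Ω, u x ≠ ⊤
  lsc : LowerSemicontinuousOn u Ω
  comparison : ∀ D : Set (EuclideanSpace ℝ (Fin n)), IsOpen D → Bornology.IsBounded D →
    closure D ⊆ Ω → ∀ h : EuclideanSpace ℝ (Fin n) → ℝ,
      ContinuousOn h (closure D) → IsPHarmonic p D h →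
      (∀ x ∈ frontier D, (h x : EReal) ≤ u x) → ∀ x ∈ D, (h x : EReal) ≤ u x

/-- The series `∑ᵢ aᵢ / |x - yᵢ|^{(n-p)/(p-1)}` with nonnegative coefficients, as an element of
`[0, ∞]`. For `p < n` a term with `aᵢ > 0` is `∞` at its pole `x = yᵢ`, and a term with `aᵢ = 0`
is identically `0`. -/
noncomputable def fundamentalSeries {n : ℕ} (p : ℝ) (a : ℕ → ℝ)
    (y : ℕ → EuclideanSpace ℝ (Fin n)) (x : EuclideanSpace ℝ (Fin n)) : ℝ≥0∞ :=
  ∑' i, ENNReal.ofReal (a i) / ENNReal.ofReal ‖x - y i‖ ^ (((n : ℝ) - p) / (p - 1))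

/-! The `p`-Laplacian is nonlinear, so superposition has no reason to preserve its supersolutions.
For `p ≥ 2`, however, there is a stronger Hessian condition, `IsDominative`, given by inequalities
linear in the Hessian; it is closed under addition and implies the supersolution property. The
fundamental solution has dominative Hessian away from its pole, and so do its smooth regularizations
`a (|x - y|² + ε)^(-s/2)` everywhere (`isSmoothDominative_fundamental`). Affine functions trivially
qualify.

A smooth dominative `V` is a weak supersolution (`integral_nonneg_of_isDominative`), so a
`p`-harmonic `h` with `h ≤ V` on `∂D` satisfies `h ≤ V` in `D`
(`IsPHarmonic.le_of_isSmoothDominative`). The test function is `χ β(hₘ - V - δ)`, with `hₘ` a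
mollification of `h` and `β` smooth, increasing and zero exactly on `(-∞, 0]`. In the limit, strict
monotonicity of the flux `|ξ|^(p-2) ξ` forces `∇h = ∇V` wherever the weight `χ β'(h - V - δ)` is
nonzero; an integration by parts against a coordinate function then gives `χ β(h - V - δ) = 0`
almost everywhere.

For the series, suppose `h` exceeds `W` at `x`. Replace `K` by an affine majorant nearly sharp at
`x`. The regularized partial sums increase to the series, so by compactness one of them, plus this
majorant and a small constant, exceeds `h` on all of `∂D`. Comparison carries this bound to `x`, a
contradiction (`IsPHarmonic.le_fundamentalSeries_add`). -/

open Filter Topology Set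
open scoped Convolution
open ContinuousLinearMap (lsmul)

/-! ### Dominative Hessians and weak supersolutions. -/

/-- The trace of an endomorphism of Euclidean space, in the standard basis. -/
noncomputable def stdTrace {n : ℕ}
    (T : EuclideanSpace ℝ (Fin n) →L[ℝ] EuclideanSpace ℝ (Fin n)) : ℝ :=
  ∑ j, inner ℝ (T (EuclideanSpace.basisFun (Fin n) ℝ j)) (EuclideanSpace.basisFun (Fin n) ℝ j)

/-- The Hessian inequality expressing that the dominative `p`-Laplacian is nonpositive. For `κ = 0`
it reads `tr T + (p - 2) ⟨T u, u⟩ ≤ 0` on unit vectors; for `κ → ∞` it gives `tr T ≤ 0`. -/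
def IsDominative {n : ℕ} (p : ℝ)
    (T : EuclideanSpace ℝ (Fin n) →L[ℝ] EuclideanSpace ℝ (Fin n)) : Prop :=
  ∀ (u : EuclideanSpace ℝ (Fin n)) (κ : ℝ), 0 ≤ κ →
    (‖u‖ ^ 2 + κ) * stdTrace T + (p - 2) * inner ℝ (T u) u ≤ 0

theorem integral_fderiv_eq_zero {E : Type*} [NormedAddCommGroup E] [NormedSpace ℝ E]
    [FiniteDimensional ℝ E] [MeasurableSpace E] [BorelSpace E] (μ : Measure E)
    [μ.IsAddHaarMeasure] {f : E → ℝ} (hf : ContDiff ℝ 1 f) (hs : HasCompactSupport f) (v : E) :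
    ∫ x, fderiv ℝ f x v ∂μ = 0 := by
  have hc : Continuous fun x => fderiv ℝ f x v := (hf.continuous_fderiv one_ne_zero).clm_apply
    continuous_const
  have hs' : HasCompactSupport fun x => fderiv ℝ f x v :=
    (hs.fderiv (𝕜 := ℝ)).comp_left (g := fun T : E →L[ℝ] ℝ => T v) (by simp)
  have h := integral_mul_fderiv_eq_neg_fderiv_mul_of_integrable (μ := μ) (f := fun _ : E => (1 : ℝ))
    (g := f) (v := v) (by simp) (by simpa using hc.integrable_of_hasCompactSupport hs')
    (by simpa using hf.continuous.integrable_of_hasCompactSupport hs) (by fun_prop)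
    (fun x _ => hf.differentiable one_ne_zero x)
  simpa using h

/-- The trace of the derivative is the divergence; each diagonal entry is a directional derivative
of a compactly supported component of the field. -/
theorem integral_stdTrace_fderiv_eq_zero {n : ℕ}
    {Y : EuclideanSpace ℝ (Fin n) → EuclideanSpace ℝ (Fin n)} (hY : ContDiff ℝ 1 Y)
    (hs : HasCompactSupport Y) : ∫ x, stdTrace (fderiv ℝ Y x) = 0 := by
  unfold stdTrace
  have key : ∀ e : EuclideanSpace ℝ (Fin n),
      Continuous (fun x => inner ℝ (fderiv ℝ Y x e) e) ∧
      HasCompactSupport (fun x => inner ℝ (fderiv ℝ Y x e) e) ∧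
      ∫ x, inner ℝ (fderiv ℝ Y x e) e = (0 : ℝ) := by
    intro e
    have hd : ∀ x, fderiv ℝ (fun x => inner ℝ (Y x) e) x e = inner ℝ (fderiv ℝ Y x e) e := by
      intro x
      rw [fderiv_inner_apply ℝ (hY.differentiable one_ne_zero x) (differentiableAt_const e)]
      simp
    refine ⟨((hY.continuous_fderiv one_ne_zero).clm_apply continuous_const).inner
      continuous_const, (hs.fderiv (𝕜 := ℝ)).comp_left
        (g := fun T : EuclideanSpace ℝ (Fin n) →L[ℝ] EuclideanSpace ℝ (Fin n) =>
          inner ℝ (T e) e) (by simp), ?_⟩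
    simp_rw [← hd]
    exact integral_fderiv_eq_zero volume (hY.inner ℝ contDiff_const)
      (hs.comp_left (g := fun v => inner ℝ v e) (by simp)) e
  rw [integral_finsetSum _ fun j _ => (key _).1.integrable_of_hasCompactSupport (key _).2.1]
  exact Finset.sum_eq_zero fun j _ => (key _).2.2

theorem sum_basisFun_mul_inner {n : ℕ} (l : EuclideanSpace ℝ (Fin n) →L[ℝ] ℝ)
    (v : EuclideanSpace ℝ (Fin n)) :
    ∑ j, l (EuclideanSpace.basisFun (Fin n) ℝ j) *
      inner ℝ v (EuclideanSpace.basisFun (Fin n) ℝ j) = l v := by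
  conv_rhs => rw [← (EuclideanSpace.basisFun (Fin n) ℝ).sum_repr v]
  rw [map_sum]
  refine Finset.sum_congr rfl fun j _ => ?_
  rw [map_smul, smul_eq_mul, OrthonormalBasis.repr_apply_apply, real_inner_comm, mul_comm]

/-- The regularized `p`-Laplace operator is nonpositive on functions with dominative Hessian,
tested against `φ`. -/
theorem integral_regularized_nonneg {n : ℕ} {p : ℝ}
    {Q : EuclideanSpace ℝ (Fin n) → EuclideanSpace ℝ (Fin n)} (hQ : ContDiff ℝ 1 Q)
    (hdom : ∀ x, IsDominative p (fderiv ℝ Q x)) {φ : EuclideanSpace ℝ (Fin n) → ℝ}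
    (hφ : ContDiff ℝ 1 φ) (hs : HasCompactSupport φ) (h0 : ∀ x, 0 ≤ φ x) {κ : ℝ} (hκ : 0 < κ) :
    0 ≤ ∫ x, (‖Q x‖ ^ 2 + κ) ^ ((p - 2) / 2) * fderiv ℝ φ x (Q x) := by
  set r : EuclideanSpace ℝ (Fin n) → ℝ := fun x => ‖Q x‖ ^ 2 + κ with hr
  have hr0 : ∀ x, 0 < r x := fun x => by positivity
  have hrC : ContDiff ℝ 1 r := (hQ.norm_sq ℝ).add contDiff_const
  -- The field `ψ • Q` has divergence equal to the integrand plus `φ` times a nonnegative multiple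
  -- of the dominative expression at `u = Q x`. Its integral is zero and the second part is
  -- nonpositive. Taking `κ > 0` keeps the power smooth where `Q` vanishes.
  set ψ : EuclideanSpace ℝ (Fin n) → ℝ := fun x => φ x * r x ^ ((p - 2) / 2) with hψ
  have hψC : ContDiff ℝ 1 ψ := hφ.mul (hrC.rpow_const_of_ne fun x => (hr0 x).ne')
  have hY : ContDiff ℝ 1 (fun x => ψ x • Q x) := hψC.smul hQ
  have hYs : HasCompactSupport (fun x => ψ x • Q x) := (hs.mul_right).smul_right
  have hψd : ∀ x u, fderiv ℝ ψ x u = r x ^ ((p - 2) / 2) * fderiv ℝ φ x u +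
      φ x * ((p - 2) * r x ^ ((p - 2) / 2 - 1) * inner ℝ (Q x) (fderiv ℝ Q x u)) := by
    intro x u
    have h1 : HasFDerivAt r (2 • (innerSL ℝ (Q x)).comp (fderiv ℝ Q x)) x :=
      ((hQ.differentiable one_ne_zero x).hasFDerivAt.norm_sq).add_const κ
    have h2 := h1.rpow_const (p := (p - 2) / 2) (Or.inl (hr0 x).ne')
    have h3 := (hφ.differentiable one_ne_zero x).hasFDerivAt.mul h2
    rw [show fderiv ℝ ψ x = _ from h3.fderiv]
    simp
    ring
  have htr : ∀ x, stdTrace (fderiv ℝ (fun x => ψ x • Q x) x) =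
      r x ^ ((p - 2) / 2) * fderiv ℝ φ x (Q x) + φ x * (r x ^ ((p - 2) / 2 - 1) *
        ((‖Q x‖ ^ 2 + κ) * stdTrace (fderiv ℝ Q x) +
          (p - 2) * inner ℝ (fderiv ℝ Q x (Q x)) (Q x))) := by
    intro x
    have h1 := (hψC.differentiable one_ne_zero x).hasFDerivAt.smul
      (hQ.differentiable one_ne_zero x).hasFDerivAt
    have h2 : r x ^ ((p - 2) / 2) = r x ^ ((p - 2) / 2 - 1) * (‖Q x‖ ^ 2 + κ) := by
      rw [Real.rpow_sub_one (hr0 x).ne']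
      exact (div_mul_cancel₀ _ (hr0 x).ne').symm
    have h3 : stdTrace (fderiv ℝ (fun x => ψ x • Q x) x) =
        ψ x * stdTrace (fderiv ℝ Q x) + fderiv ℝ ψ x (Q x) := by
      rw [← sum_basisFun_mul_inner (fderiv ℝ ψ x) (Q x),
        show fderiv ℝ (fun x => ψ x • Q x) x = _ from h1.fderiv]
      unfold stdTrace
      rw [Finset.mul_sum, ← Finset.sum_add_distrib]
      refine Finset.sum_congr rfl fun j _ => ?_
      simp [inner_add_left, inner_smul_left]
    rw [h3, hψd, hψ, real_inner_comm (Q x)]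
    simp only [h2]
    ring
  have hc1 : Continuous fun x => r x ^ ((p - 2) / 2) * fderiv ℝ φ x (Q x) :=
    ((hrC.rpow_const_of_ne fun x => (hr0 x).ne').continuous).mul
      ((hφ.continuous_fderiv one_ne_zero).clm_apply hQ.continuous)
  have hs1 : HasCompactSupport fun x => r x ^ ((p - 2) / 2) * fderiv ℝ φ x (Q x) := by
    refine HasCompactSupport.mul_left ?_
    refine (hs.fderiv (𝕜 := ℝ)).mono ?_
    intro x hx
    contrapose! hx
    simp only [Function.mem_support, not_not] at hx ⊢
    simp [hx]
  have hc2 : Continuous fun x => stdTrace (fderiv ℝ (fun x => ψ x • Q x) x) := by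
    unfold stdTrace
    exact continuous_finsetSum _ fun j _ =>
      ((hY.continuous_fderiv one_ne_zero).clm_apply continuous_const).inner continuous_const
  have hs2 : HasCompactSupport fun x => stdTrace (fderiv ℝ (fun x => ψ x • Q x) x) :=
    (hYs.fderiv (𝕜 := ℝ)).comp_left (g := stdTrace) (by simp [stdTrace])
  rw [← integral_stdTrace_fderiv_eq_zero hY hYs]
  refine integral_mono (hc2.integrable_of_hasCompactSupport hs2)
    (hc1.integrable_of_hasCompactSupport hs1) fun x => ?_
  simp only [htr]
  have := mul_nonneg (h0 x) (Real.rpow_nonneg (hr0 x).le ((p - 2) / 2 - 1))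
  nlinarith [mul_nonneg this (neg_nonneg.2 (hdom x (Q x) κ hκ.le))]

/-- A `C²` function with dominative Hessian is a weak supersolution of the `p`-Laplace equation. -/
theorem integral_nonneg_of_isDominative {n : ℕ} {p : ℝ} (hp : 2 ≤ p)
    {Q : EuclideanSpace ℝ (Fin n) → EuclideanSpace ℝ (Fin n)} (hQ : ContDiff ℝ 1 Q)
    (hdom : ∀ x, IsDominative p (fderiv ℝ Q x)) {φ : EuclideanSpace ℝ (Fin n) → ℝ}
    (hφ : ContDiff ℝ 1 φ) (hs : HasCompactSupport φ) (h0 : ∀ x, 0 ≤ φ x) :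
    0 ≤ ∫ x, ‖Q x‖ ^ (p - 2) * fderiv ℝ φ x (Q x) := by
  have hp2 : 0 ≤ (p - 2) / 2 := by linarith
  have hpow : ∀ x, ‖Q x‖ ^ (p - 2) = (‖Q x‖ ^ 2) ^ ((p - 2) / 2) := fun x => by
    rw [← Real.rpow_natCast, ← Real.rpow_mul (norm_nonneg _)]
    congr 1
    push_cast
    ring
  have hcd : Continuous fun x => fderiv ℝ φ x (Q x) :=
    (hφ.continuous_fderiv one_ne_zero).clm_apply hQ.continuous
  have hsd : HasCompactSupport fun x => fderiv ℝ φ x (Q x) := by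
    refine (hs.fderiv (𝕜 := ℝ)).mono fun x hx => ?_
    contrapose! hx
    simp only [Function.mem_support, not_not] at hx ⊢
    simp [hx]
  have hcont : ∀ κ : ℝ, Continuous fun x => (‖Q x‖ ^ 2 + κ) ^ ((p - 2) / 2) * fderiv ℝ φ x (Q x) :=
    fun κ => (((hQ.continuous.norm.pow 2).add continuous_const).rpow_const
      fun x => Or.inr hp2).mul hcd
  -- Since `(p - 2) / 2 ≥ 0`, the integrands with `κ < 1` are dominated by the one with `κ = 1`.
  have hlim : Tendsto (fun κ : ℝ => ∫ x, (‖Q x‖ ^ 2 + κ) ^ ((p - 2) / 2) * fderiv ℝ φ x (Q x))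
      (𝓝[>] 0) (𝓝 (∫ x, ‖Q x‖ ^ (p - 2) * fderiv ℝ φ x (Q x))) := by
    refine tendsto_integral_filter_of_dominated_convergence
      (fun x => ‖(‖Q x‖ ^ 2 + 1) ^ ((p - 2) / 2) * fderiv ℝ φ x (Q x)‖)
      (Eventually.of_forall fun κ => (hcont κ).aestronglyMeasurable) ?_
      ((hcont 1).integrable_of_hasCompactSupport hsd.mul_left).norm ?_
    · filter_upwards [Ioo_mem_nhdsGT (zero_lt_one' ℝ)] with κ hκ
      refine Eventually.of_forall fun x => ?_
      rw [norm_mul, norm_mul]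
      refine mul_le_mul_of_nonneg_right ?_ (norm_nonneg _)
      have : 0 < κ := hκ.1
      rw [Real.norm_of_nonneg (by positivity), Real.norm_of_nonneg (by positivity)]
      exact Real.rpow_le_rpow (by positivity) (by linarith [hκ.2]) hp2
    · refine Eventually.of_forall fun x => ?_
      rw [hpow]
      refine Tendsto.mul_const _ ?_
      have : Continuous fun κ : ℝ => (‖Q x‖ ^ 2 + κ) ^ ((p - 2) / 2) :=
        (continuous_const.add continuous_id).rpow_const fun _ => Or.inr hp2
      simpa using (this.tendsto 0).mono_left nhdsWithin_le_nhds
  refine ge_of_tendsto hlim ?_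
  filter_upwards [self_mem_nhdsWithin] with κ hκ
  exact integral_regularized_nonneg hQ hdom hφ hs h0 hκ

/-! ### Passage to the limit by Fatou's lemma. -/

/-- Fatou's lemma in the form: if `fₘ ≥ -gₘ` and `∫ gₘ = ∫ g` for all `m`, where `fₘ → f` and
`gₘ → g` almost everywhere, then `∫ fₘ ≤ 0` passes to the limit. -/
theorem integral_nonpos_of_tendsto_ae {α : Type*} [MeasurableSpace α] {μ : Measure α}
    {f g : ℕ → α → ℝ} {F G : α → ℝ} (hf : ∀ m, Integrable (f m) μ) (hg : ∀ m, Integrable (g m) μ)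
    (hF : Integrable F μ) (hG : Integrable G μ) (hfg : ∀ m x, -g m x ≤ f m x)
    (hfl : ∀ᵐ x ∂μ, Tendsto (fun m => f m x) atTop (𝓝 (F x)))
    (hgl : ∀ᵐ x ∂μ, Tendsto (fun m => g m x) atTop (𝓝 (G x)))
    (hgi : ∀ m, ∫ x, g m x ∂μ = ∫ x, G x ∂μ) (hfi : ∀ m, ∫ x, f m x ∂μ ≤ 0) :
    ∫ x, F x ∂μ ≤ 0 := by
  have hFG0 : ∀ᵐ x ∂μ, 0 ≤ F x + G x := by
    filter_upwards [hfl, hgl] with x h1 h2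
    exact ge_of_tendsto' (h1.add h2) fun m => by linarith [hfg m x]
  -- Fatou's lemma applies to the nonnegative functions `f m + g m`; because the integrals of `g m`
  -- do not depend on `m`, the contribution of `G` cancels at the end.
  have hI : ∫ x, (F x + G x) ∂μ ≤ ∫ x, G x ∂μ := by
    rw [integral_eq_lintegral_of_nonneg_ae hFG0 (hF.add hG).aestronglyMeasurable]
    have hG0 : 0 ≤ ∫ x, G x ∂μ := by
      have h1 : 0 ≤ ∫ x, (f 0 x + g 0 x) ∂μ :=
        integral_nonneg fun x => by simpa using by linarith [hfg 0 x]
      rw [integral_add (hf 0) (hg 0), hgi 0] at h1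
      linarith [hfi 0]
    refine ENNReal.toReal_le_of_le_ofReal hG0 ?_
    calc ∫⁻ x, ENNReal.ofReal (F x + G x) ∂μ
        = ∫⁻ x, liminf (fun m => ENNReal.ofReal (f m x + g m x)) atTop ∂μ := by
          refine lintegral_congr_ae ?_
          filter_upwards [hfl, hgl] with x h1 h2
          exact ((ENNReal.continuous_ofReal.tendsto _).comp (h1.add h2)).liminf_eq.symm
      _ ≤ liminf (fun m => ∫⁻ x, ENNReal.ofReal (f m x + g m x) ∂μ) atTop :=
          lintegral_liminf_le' fun m =>
            ((hf m).add (hg m)).aestronglyMeasurable.aemeasurable.ennreal_ofReal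
      _ ≤ liminf (fun _ : ℕ => ENNReal.ofReal (∫ x, G x ∂μ)) atTop := by
          refine liminf_le_liminf (Eventually.of_forall fun m => ?_)
          refine (ofReal_integral_eq_lintegral_ofReal ((hf m).add (hg m))
            (Eventually.of_forall fun x => by simpa using by linarith [hfg m x])).ge.trans ?_
          refine ENNReal.ofReal_le_ofReal ?_
          simp only [Pi.add_apply]
          rw [integral_add (hf m) (hg m), hgi m]
          linarith [hfi m]
      _ = ENNReal.ofReal (∫ x, G x ∂μ) := liminf_const _
  rw [integral_add hF hG] at hI
  linarith

/-! ### Monotonicity of the `p`-Laplace flux. -/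

section Monotone

variable {E : Type*} [NormedAddCommGroup E] [InnerProductSpace ℝ E]

/-- The right side minus the left equals `(‖a‖^(p-2) - ‖b‖^(p-2)) (‖a‖² - ‖b‖²) / 2`, whose two
factors have the same sign since `p ≥ 2`. -/
theorem rpow_norm_smul_sub_inner_ge {p : ℝ} (hp : 2 ≤ p) (a b : E) :
    (‖a‖ ^ (p - 2) + ‖b‖ ^ (p - 2)) / 2 * ‖a - b‖ ^ 2 ≤
      inner ℝ (‖a‖ ^ (p - 2) • a - ‖b‖ ^ (p - 2) • b) (a - b) := by
  have h : 0 ≤ (‖a‖ ^ (p - 2) - ‖b‖ ^ (p - 2)) * (‖a‖ ^ 2 - ‖b‖ ^ 2) := by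
    rcases le_total ‖a‖ ‖b‖ with hab | hab
    · exact mul_nonneg_of_nonpos_of_nonpos
        (sub_nonpos.2 (Real.rpow_le_rpow (norm_nonneg _) hab (by linarith)))
        (sub_nonpos.2 (pow_le_pow_left₀ (norm_nonneg _) hab 2))
    · exact mul_nonneg
        (sub_nonneg.2 (Real.rpow_le_rpow (norm_nonneg _) hab (by linarith)))
        (sub_nonneg.2 (pow_le_pow_left₀ (norm_nonneg _) hab 2))
  have e1 := norm_sub_sq_real a b
  simp only [inner_sub_left, inner_sub_right, real_inner_smul_left, real_inner_self_eq_norm_sq]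
  rw [real_inner_comm a b, e1]
  nlinarith [h]

theorem rpow_norm_smul_sub_inner_nonneg {p : ℝ} (hp : 2 ≤ p) (a b : E) :
    0 ≤ inner ℝ (‖a‖ ^ (p - 2) • a - ‖b‖ ^ (p - 2) • b) (a - b) :=
  le_trans (by positivity) (rpow_norm_smul_sub_inner_ge hp a b)

theorem eq_of_rpow_norm_smul_sub_inner_eq_zero {p : ℝ} (hp : 2 ≤ p) {a b : E}
    (h : inner ℝ (‖a‖ ^ (p - 2) • a - ‖b‖ ^ (p - 2) • b) (a - b) = 0) : a = b := by
  by_contra hab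
  have h1 := rpow_norm_smul_sub_inner_ge hp a b
  have h2 : 0 < ‖a - b‖ := norm_pos_iff.2 (sub_ne_zero.2 hab)
  have h3 : 0 < ‖a‖ ^ (p - 2) + ‖b‖ ^ (p - 2) := by
    rcases eq_or_ne a 0 with rfl | ha
    · have hb : 0 < ‖b‖ := by simpa using h2
      positivity
    · have ha : 0 < ‖a‖ := norm_pos_iff.2 ha
      positivity
  rw [h] at h1
  have : 0 < (‖a‖ ^ (p - 2) + ‖b‖ ^ (p - 2)) / 2 * ‖a - b‖ ^ 2 := by positivity
  linarith

end Monotone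

/-- Bernoulli's inequality at `t / b - 1`, multiplied by `b ^ p`. This tangent-line bound drives the
Jensen inequality for mollifications. -/
theorem rpow_add_mul_sub_le_rpow {p b t : ℝ} (hp : 1 ≤ p) (hb : 0 ≤ b) (ht : 0 ≤ t) :
    b ^ p + p * b ^ (p - 1) * (t - b) ≤ t ^ p := by
  rcases hb.eq_or_lt with rfl | hb
  · rw [Real.zero_rpow (by linarith)]
    rcases hp.eq_or_lt with rfl | hp
    · simp
    · rw [Real.zero_rpow (by linarith)]
      simpa using Real.rpow_nonneg ht p
  · have h := one_add_mul_self_le_rpow_one_add (s := t / b - 1) (by linarith [div_nonneg ht hb.le]) hp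
    rw [add_sub_cancel, Real.div_rpow ht hb.le, le_div_iff₀ (by positivity)] at h
    refine le_trans (le_of_eq ?_) h
    rw [Real.rpow_sub_one hb.ne']
    field_simp

/-! ### Mollification: Jensen's inequality, weak gradients, limits of integrals. -/

section Mollify

variable {n : ℕ} {F : Type*} [NormedAddCommGroup F] [NormedSpace ℝ F]

/-- Jensen's inequality for mollification. -/
theorem norm_rpow_normed_convolution_le {p : ℝ} (hp : 1 ≤ p)
    (ρ : ContDiffBump (0 : EuclideanSpace ℝ (Fin n))) {G : EuclideanSpace ℝ (Fin n) → F}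
    (hG : Integrable G) (hGp : Integrable fun x => ‖G x‖ ^ p) (x : EuclideanSpace ℝ (Fin n)) :
    ‖(ρ.normed volume ⋆[lsmul ℝ ℝ, volume] G) x‖ ^ p ≤
      (ρ.normed volume ⋆[lsmul ℝ ℝ, volume] fun x => ‖G x‖ ^ p) x := by
  have hex : ∀ {F' : Type _} [NormedAddCommGroup F'] [NormedSpace ℝ F']
      {g : EuclideanSpace ℝ (Fin n) → F'},
      Integrable g → Integrable fun t => ρ.normed volume t • g (x - t) := by
    intro F' _ _ g hg
    exact (ρ.hasCompactSupport_normed.convolutionExists_left (lsmul ℝ ℝ)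
      ρ.continuous_normed hg.locallyIntegrable x).integrable
  set b := ‖(ρ.normed volume ⋆[lsmul ℝ ℝ, volume] G) x‖ with hb
  have hbI : b ≤ ∫ t, ρ.normed volume t * ‖G (x - t)‖ := by
    refine (norm_integral_le_integral_norm _).trans (le_of_eq ?_)
    refine integral_congr_ae (Eventually.of_forall fun t => ?_)
    simp [norm_smul, abs_of_nonneg (ρ.nonneg_normed t)]
  have i1 : Integrable fun t => ρ.normed volume t * ‖G (x - t)‖ := hex hG.norm
  have i2 : Integrable fun t => ρ.normed volume t * ‖G (x - t)‖ ^ p := hex hGp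
  have i0 : Integrable fun t => ρ.normed volume t := ρ.integrable_normed
  -- The tangent-line bound at `b`, averaged against the probability density of the mollifier; its
  -- linear part is nonnegative after averaging by `hbI`.
  have hlow : ∫ t, ((b ^ p - p * b ^ (p - 1) * b) * ρ.normed volume t +
      p * b ^ (p - 1) * (ρ.normed volume t * ‖G (x - t)‖)) ≤
      ∫ t, ρ.normed volume t * ‖G (x - t)‖ ^ p := by
    refine integral_mono ((i0.const_mul _).add (i1.const_mul _)) i2 fun t => ?_
    have := mul_le_mul_of_nonneg_left
      (rpow_add_mul_sub_le_rpow hp (norm_nonneg _) (norm_nonneg (G (x - t))) (b := b))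
      (ρ.nonneg_normed (μ := volume) t)
    simp only
    linarith
  rw [integral_add (i0.const_mul _) (i1.const_mul _), integral_const_mul, integral_const_mul,
    ρ.integral_normed] at hlow
  have h0 : 0 ≤ p * b ^ (p - 1) := by positivity
  have := mul_le_mul_of_nonneg_left hbI h0
  calc b ^ p ≤ ∫ t, ρ.normed volume t * ‖G (x - t)‖ ^ p := by linarith
    _ = _ := rfl

theorem integrable_normed_convolution (ρ : ContDiffBump (0 : EuclideanSpace ℝ (Fin n)))
    {G : EuclideanSpace ℝ (Fin n) → F} (hG : Integrable G) :
    Integrable (ρ.normed volume ⋆[lsmul ℝ ℝ, volume] G) :=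
  Integrable.integrable_convolution (lsmul ℝ ℝ) ρ.integrable_normed hG

theorem integral_normed_convolution (ρ : ContDiffBump (0 : EuclideanSpace ℝ (Fin n)))
    {G : EuclideanSpace ℝ (Fin n) → ℝ} (hG : Integrable G) :
    ∫ x, (ρ.normed volume ⋆[lsmul ℝ ℝ, volume] G) x = ∫ x, G x := by
  rw [integral_convolution (lsmul ℝ ℝ) ρ.integrable_normed hG, ρ.integral_normed]
  simp

end Mollify

section Mollify

variable {n : ℕ}

theorem fderiv_convolution_lsmul_apply {f g : EuclideanSpace ℝ (Fin n) → ℝ} (hf : ContDiff ℝ 1 f)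
    (hfs : HasCompactSupport f) (hg : LocallyIntegrable g) (x v : EuclideanSpace ℝ (Fin n)) :
    fderiv ℝ (f ⋆[lsmul ℝ ℝ, volume] g) x v = ∫ t, fderiv ℝ f (x - t) v * g t := by
  have i1 := ((hfs.fderiv (𝕜 := ℝ)).convolutionExists_left
      (ContinuousLinearMap.precompL (EuclideanSpace ℝ (Fin n)) (lsmul ℝ ℝ : ℝ →L[ℝ] ℝ →L[ℝ] ℝ))
      (hf.continuous_fderiv one_ne_zero) hg x).integrable_swap
  rw [(hfs.hasFDerivAt_convolution_left (lsmul ℝ ℝ) hf hg x).fderiv, convolution_eq_swap,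
    ContinuousLinearMap.integral_apply i1]
  rfl

theorem fderiv_comp_sub_left_apply {f : EuclideanSpace ℝ (Fin n) → ℝ} (hf : ContDiff ℝ 1 f)
    (x t v : EuclideanSpace ℝ (Fin n)) :
    fderiv ℝ (fun s => f (x - s)) t v = -fderiv ℝ f (x - t) v := by
  have h1 := ((hf.differentiable one_ne_zero (x - t)).hasFDerivAt).comp t
    ((hasFDerivAt_id t).const_sub x)
  rw [show fderiv ℝ (fun s => f (x - s)) t = _ from h1.fderiv]
  simp

/-- The gradient of a mollification is the mollification of the weak gradient. -/
theorem fderiv_normed_convolution_of_isWeakGradient {Ω L : Set (EuclideanSpace ℝ (Fin n))}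
    {h : EuclideanSpace ℝ (Fin n) → ℝ} {G : EuclideanSpace ℝ (Fin n) → EuclideanSpace ℝ (Fin n)}
    (hΩ : MeasurableSet Ω) (hG : IsWeakGradient Ω h G) (hLΩ : L ⊆ Ω)
    (hhL : Integrable (L.indicator h)) (hGL : Integrable (L.indicator G))
    (ρ : ContDiffBump (0 : EuclideanSpace ℝ (Fin n))) {x : EuclideanSpace ℝ (Fin n)}
    (hx : Metric.closedBall x ρ.rOut ⊆ L) (v : EuclideanSpace ℝ (Fin n)) :
    fderiv ℝ (ρ.normed volume ⋆[lsmul ℝ ℝ, volume] L.indicator h) x v =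
      inner ℝ ((ρ.normed volume ⋆[lsmul ℝ ℝ, volume] L.indicator G) x) v := by
  set ρn := ρ.normed (volume : Measure (EuclideanSpace ℝ (Fin n))) with hρn
  have hρC : ContDiff ℝ ∞ ρn := ρ.contDiff_normed
  have hρC1 : ContDiff ℝ 1 ρn := ρ.contDiff_normed (n := 1)
  have hρs : HasCompactSupport ρn := ρ.hasCompactSupport_normed
  -- The reflected, translated mollifier is an admissible test function because the ball around `x`
  -- lies in `L ⊆ Ω`. The minus sign from the reflection cancels the one in the definition of the
  -- weak gradient.
  set φ : EuclideanSpace ℝ (Fin n) → ℝ := fun t => ρn (x - t) with hφ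
  have hφt : ∀ t ∉ L, φ t = 0 := by
    intro t ht
    have h1 : x - t ∉ Function.support ρn := by
      rw [hρn, ρ.support_normed_eq]
      intro h2
      refine ht (hx ?_)
      rw [Metric.mem_closedBall, dist_comm, dist_eq_norm]
      exact (mem_ball_zero_iff.1 h2).le
    simpa using h1
  have hφC : ContDiff ℝ ∞ φ := hρC.comp (contDiff_const.sub contDiff_id)
  have hsup : tsupport φ ⊆ Metric.closedBall x ρ.rOut := by
    refine closure_minimal (fun t ht => ?_) Metric.isClosed_closedBall
    have h1 : x - t ∈ Function.support ρn := ht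
    rw [hρn, ρ.support_normed_eq] at h1
    rw [Metric.mem_closedBall, dist_comm, dist_eq_norm]
    exact (mem_ball_zero_iff.1 h1).le
  have htest : IsTestFunction Ω φ :=
    ⟨hφC, HasCompactSupport.of_support_subset_isCompact (isCompact_closedBall x ρ.rOut)
      ((subset_tsupport φ).trans hsup), hsup.trans (hx.trans hLΩ)⟩
  have hd : ∀ t, fderiv ℝ φ t v = -fderiv ℝ ρn (x - t) v := fun t =>
    fderiv_comp_sub_left_apply hρC1 x t v
  have hdt : ∀ t ∉ L, fderiv ℝ φ t v = 0 := by
    intro t ht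
    have h1 : t ∉ tsupport φ := fun h2 => ht (hx (hsup h2))
    have h2 : t ∉ tsupport (fderiv ℝ φ) := fun h3 => h1 (tsupport_fderiv_subset ℝ h3)
    rw [image_eq_zero_of_notMem_tsupport h2]
    rfl
  rw [fderiv_convolution_lsmul_apply hρC1 hρs hhL.locallyIntegrable, convolution_eq_swap]
  have hw := hG φ htest v
  have e1 : ∫ t in Ω, h t * fderiv ℝ φ t v = ∫ t, L.indicator h t * fderiv ℝ φ t v := by
    rw [← integral_indicator hΩ]
    refine integral_congr_ae (Eventually.of_forall fun t => ?_)
    by_cases ht : t ∈ L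
    · simp [ht, hLΩ ht]
    · simp only [indicator_of_notMem ht, zero_mul]
      by_cases ht' : t ∈ Ω <;> simp [ht', hdt t ht]
  have e2 : ∫ t in Ω, φ t * inner ℝ (G t) v = ∫ t, φ t * inner ℝ (L.indicator G t) v := by
    rw [← integral_indicator hΩ]
    refine integral_congr_ae (Eventually.of_forall fun t => ?_)
    by_cases ht : t ∈ L
    · simp [ht, hLΩ ht]
    · by_cases ht' : t ∈ Ω <;> simp [ht', hφt t ht]
  rw [e1, e2] at hw
  have i2 : Integrable fun t => (lsmul ℝ ℝ (ρn (x - t))) (L.indicator G t) :=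
    (hρs.convolutionExists_left (lsmul ℝ ℝ) hρC1.continuous hGL.locallyIntegrable
      x).integrable_swap
  rw [real_inner_comm, ← integral_inner i2]
  have e3 : ∫ t, fderiv ℝ ρn (x - t) v * L.indicator h t =
      -∫ t, L.indicator h t * fderiv ℝ φ t v := by
    rw [← integral_neg]
    refine integral_congr_ae (Eventually.of_forall fun t => ?_)
    simp only [hd]
    ring
  rw [e3, hw, neg_neg]
  refine integral_congr_ae (Eventually.of_forall fun t => ?_)
  simp only [ContinuousLinearMap.lsmul_apply, inner_smul_right, hφ]
  rw [real_inner_comm]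

/-- Passing to the limit in an integral inequality along mollifications, under the domination
`|fₘ| ≤ C (1_L + Γ + ρₘ ⋆ Γ)`. -/
theorem integral_nonpos_of_le_normed_convolution
    {ρ : ℕ → ContDiffBump (0 : EuclideanSpace ℝ (Fin n))}
    (hρ : Tendsto (fun m => (ρ m).rOut) atTop (𝓝 0))
    (hρ2 : ∀ m, (ρ m).rOut ≤ 2 * (ρ m).rIn) {L : Set (EuclideanSpace ℝ (Fin n))}
    (hL : IsCompact L) {Γ : EuclideanSpace ℝ (Fin n) → ℝ} (hΓ : Integrable Γ) {C : ℝ}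
    {f : ℕ → EuclideanSpace ℝ (Fin n) → ℝ} {F : EuclideanSpace ℝ (Fin n) → ℝ}
    (hf : ∀ m, AEStronglyMeasurable (f m))
    (hfC : ∀ m x, |f m x| ≤ C * (L.indicator 1 x + Γ x +
      ((ρ m).normed volume ⋆[lsmul ℝ ℝ, volume] Γ) x))
    (hfl : ∀ᵐ x, Tendsto (fun m => f m x) atTop (𝓝 (F x)))
    (hfi : ∀ m, Integrable (f m) → ∫ x, f m x ≤ 0) :
    Integrable F ∧ ∫ x, F x ≤ 0 := by
  have i1 : Integrable (L.indicator (1 : EuclideanSpace ℝ (Fin n) → ℝ)) :=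
    (integrable_indicator_iff hL.measurableSet).2 (integrableOn_const hL.measure_lt_top.ne)
  have i2 : ∀ m, Integrable ((ρ m).normed volume ⋆[lsmul ℝ ℝ, volume] Γ) :=
    fun m => integrable_normed_convolution (ρ m) hΓ
  have ig : ∀ m, Integrable fun x => C * (L.indicator 1 x + Γ x +
      ((ρ m).normed volume ⋆[lsmul ℝ ℝ, volume] Γ) x) :=
    fun m => ((i1.add hΓ).add (i2 m)).const_mul C
  have iG : Integrable fun x => C * (L.indicator 1 x + Γ x + Γ x) :=
    ((i1.add hΓ).add hΓ).const_mul C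
  have hfI : ∀ m, Integrable (f m) := fun m =>
    (ig m).mono' (hf m) (Eventually.of_forall fun x => hfC m x)
  have hgl : ∀ᵐ x, Tendsto (fun m => C * (L.indicator 1 x + Γ x +
      ((ρ m).normed volume ⋆[lsmul ℝ ℝ, volume] Γ) x)) atTop
      (𝓝 (C * (L.indicator 1 x + Γ x + Γ x))) := by
    filter_upwards [ContDiffBump.ae_convolution_tendsto_right_of_locallyIntegrable hρ
      (Eventually.of_forall hρ2) hΓ.locallyIntegrable] with x hx
    exact (tendsto_const_nhds.add hx).const_mul C
  have hFI : Integrable F := by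
    refine iG.mono' (aestronglyMeasurable_of_tendsto_ae atTop hf hfl) ?_
    filter_upwards [hfl, hgl] with x h1 h2
    exact le_of_tendsto_of_tendsto' h1.norm h2 fun m => hfC m x
  refine ⟨hFI, integral_nonpos_of_tendsto_ae hfI ig hFI iG
    (fun m x => neg_le_of_abs_le (hfC m x)) hfl hgl (fun m => ?_) fun m => hfi m (hfI m)⟩
  -- Mollification preserves integrals, so all the majorants have the same integral as their limit.
  have e1 := integral_add (i1.add hΓ) (i2 m)
  have e2 := integral_add (i1.add hΓ) hΓ
  simp only [Pi.add_apply] at e1 e2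
  rw [integral_const_mul, integral_const_mul, e1, e2, integral_normed_convolution (ρ m) hΓ]

end Mollify

/-- With `s` the largest of the three numbers, the left side is at most `2 s^(p-1) * 2 s`. This
bounds the pairing of the flux difference with the mollified gradient difference by `p`-th powers.
-/
theorem rpow_sub_one_add_mul_add_le {p a b c : ℝ} (hp : 1 ≤ p) (ha : 0 ≤ a) (hb : 0 ≤ b)
    (hc : 0 ≤ c) : (a ^ (p - 1) + c ^ (p - 1)) * (b + c) ≤ 4 * (a ^ p + b ^ p + c ^ p) := by
  have key : ∀ s : ℝ, 0 ≤ s → a ≤ s → b ≤ s → c ≤ s → s ^ p ≤ a ^ p + b ^ p + c ^ p →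
      (a ^ (p - 1) + c ^ (p - 1)) * (b + c) ≤ 4 * (a ^ p + b ^ p + c ^ p) := by
    intro s hs h1 h2 h3 h4
    have e1 := Real.rpow_le_rpow ha h1 (sub_nonneg.2 hp)
    have e3 := Real.rpow_le_rpow hc h3 (sub_nonneg.2 hp)
    calc (a ^ (p - 1) + c ^ (p - 1)) * (b + c) ≤ (s ^ (p - 1) + s ^ (p - 1)) * (s + s) := by
          gcongr
      _ = 4 * (s ^ (p - 1) * s) := by ring
      _ = 4 * s ^ p := by
          rw [← Real.rpow_add_one' hs (by linarith), sub_add_cancel]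
      _ ≤ _ := by linarith
  have ha' := Real.rpow_nonneg ha p
  have hb' := Real.rpow_nonneg hb p
  have hc' := Real.rpow_nonneg hc p
  rcases le_total a b with hab | hab <;> rcases le_total b c with hbc | hbc <;>
    rcases le_total a c with hac | hac
  · exact key c hc hac hbc le_rfl (by linarith)
  · exact key c hc (hab.trans hbc) hbc le_rfl (by linarith)
  · exact key b hb hab le_rfl hbc (by linarith)
  · exact key b hb hab le_rfl hbc (by linarith)
  · exact key c hc hac hbc le_rfl (by linarith)
  · exact key a ha le_rfl hab hac (by linarith)
  · exact key a ha le_rfl hab (hbc.trans hab) (by linarith)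
  · exact key a ha le_rfl hab hac (by linarith)

/-- A smooth cutoff equal to `1` near the compact set `S` and vanishing off a compact set `T`
contained in the open set `D`. -/
theorem exists_smooth_cutoff {n : ℕ} {S D : Set (EuclideanSpace ℝ (Fin n))} (hS : IsCompact S)
    (hD : IsOpen D) (hSD : S ⊆ D) :
    ∃ (χ : EuclideanSpace ℝ (Fin n) → ℝ) (T : Set (EuclideanSpace ℝ (Fin n))), ContDiff ℝ ∞ χ ∧
      IsCompact T ∧ T ⊆ D ∧ tsupport χ ⊆ T ∧ (∀ x ∈ S, ∀ᶠ y in 𝓝 x, χ y = 1) ∧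
      ∀ x, χ x ∈ Icc 0 1 := by
  obtain ⟨T, hT, hST, hTD⟩ := exists_compact_between hS hD hSD
  obtain ⟨f, h1, h2, h3⟩ := exists_contMDiffMap_one_nhds_of_subset_interior
    (modelWithCornersSelf ℝ (EuclideanSpace ℝ (Fin n))) (n := ⊤) hS.isClosed hST
  refine ⟨f, T, f.contMDiff.contDiff, hT, hTD, ?_, ?_, h3⟩
  · refine closure_minimal (fun x hx => ?_) hT.isClosed
    by_contra hxT
    exact hx (h2 x hxT)
  · intro x hx
    exact h1.filter_mono (nhds_le_nhdsSet hx)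

/-! ### Comparison of a `p`-harmonic function with a smooth supersolution. -/

section Comparison

variable {n : ℕ}

/-- No term with the derivative of `χ` survives: at each point of `T` either `χ` is locally constant
or `expNegInvGlue` vanishes. -/
theorem fderiv_mul_expNegInvGlue_apply {χ u V : EuclideanSpace ℝ (Fin n) → ℝ}
    {g Q : EuclideanSpace ℝ (Fin n) → EuclideanSpace ℝ (Fin n)} {δ : ℝ}
    {T : Set (EuclideanSpace ℝ (Fin n))} (hχ : ContDiff ℝ ∞ χ) (hχT : tsupport χ ⊆ T)
    (hu : ContDiff ℝ ∞ u) (hV : ContDiff ℝ ∞ V)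
    (hT : ∀ x ∈ T, (∀ᶠ y in 𝓝 x, χ y = 1) ∨ u x - V x - δ ≤ 0)
    (hug : ∀ x ∈ T, ∀ v, fderiv ℝ u x v = inner ℝ (g x) v)
    (hVQ : ∀ x v, fderiv ℝ V x v = inner ℝ (Q x) v) (x v : EuclideanSpace ℝ (Fin n)) :
    fderiv ℝ (fun y => χ y * expNegInvGlue (u y - V y - δ)) x v =
      χ x * deriv expNegInvGlue (u x - V x - δ) * inner ℝ (g x - Q x) v := by
  have hβ : ContDiff ℝ ∞ expNegInvGlue := expNegInvGlue.contDiff (n := ⊤)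
  have htop : (∞ : WithTop ℕ∞) ≠ 0 := by simp
  by_cases hx : x ∈ T
  · have h1 : HasFDerivAt (fun y => u y - V y - δ) (fderiv ℝ u x - fderiv ℝ V x) x :=
      (((hu.differentiable htop x).hasFDerivAt).sub
        ((hV.differentiable htop x).hasFDerivAt)).sub_const δ
    have h2 := ((hβ.differentiable htop (u x - V x - δ)).hasDerivAt).comp_hasFDerivAt x h1
    have h3 := ((hχ.differentiable htop x).hasFDerivAt).mul h2
    rw [show fderiv ℝ (fun y => χ y * expNegInvGlue (u y - V y - δ)) x = _ from h3.fderiv]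
    have h4 : expNegInvGlue (u x - V x - δ) * fderiv ℝ χ x v = 0 := by
      rcases hT x hx with h | h
      · have : fderiv ℝ χ x = 0 := by
          rw [Filter.EventuallyEq.fderiv_eq (f := fun _ => (1 : ℝ)) h]
          simp
        simp [this]
      · simp [expNegInvGlue.zero_of_nonpos h]
    simp only [add_apply, smul_apply, sub_apply, smul_eq_mul, Function.comp_apply, hug x hx, hVQ,
      inner_sub_left]
    linarith
  · have h0 : χ =ᶠ[𝓝 x] 0 := notMem_tsupport_iff_eventuallyEq.1 fun h => hx (hχT h)
    have h1 : (fun y => χ y * expNegInvGlue (u y - V y - δ)) =ᶠ[𝓝 x] fun _ => (0 : ℝ) := by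
      filter_upwards [h0] with y hy
      simp [hy]
    rw [h1.fderiv_eq, h0.self_of_nhds]
    simp

/-- The hypotheses under which mollifications of a `p`-harmonic function `h` are compared with a
smooth supersolution `V` by testing with `χ · β(hₘ - V - δ)`. -/
structure ComparisonData (p : ℝ) (D T L : Set (EuclideanSpace ℝ (Fin n)))
    (h V χ : EuclideanSpace ℝ (Fin n) → ℝ)
    (G Q : EuclideanSpace ℝ (Fin n) → EuclideanSpace ℝ (Fin n)) (δ : ℝ)
    (ρ : ℕ → ContDiffBump (0 : EuclideanSpace ℝ (Fin n))) : Prop where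
  two_le : 2 ≤ p
  isOpen : IsOpen D
  isCompact_T : IsCompact T
  isCompact_L : IsCompact L
  L_subset : L ⊆ D
  continuousOn : ContinuousOn h D
  memLp : MemLpLoc p D G
  weakGradient : IsWeakGradient D h G
  harmonic : ∀ φ : EuclideanSpace ℝ (Fin n) → ℝ, IsTestFunction D φ →
    ∫ x in D, ‖G x‖ ^ (p - 2) * fderiv ℝ φ x (G x) = 0
  smooth_V : ContDiff ℝ ∞ V
  smooth_Q : ContDiff ℝ 1 Q
  fderiv_V : ∀ x v, fderiv ℝ V x v = inner ℝ (Q x) v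
  hessian_le : ∀ x, IsDominative p (fderiv ℝ Q x)
  smooth_χ : ContDiff ℝ ∞ χ
  tsupport_χ : tsupport χ ⊆ T
  χ_mem : ∀ x, χ x ∈ Icc (0 : ℝ) 1
  cutoff : ∀ x ∈ T, (∀ᶠ y in 𝓝 x, χ y = 1) ∨ h x - V x ≤ δ / 2
  δ_pos : 0 < δ
  rOut_tendsto : Tendsto (fun m => (ρ m).rOut) atTop (𝓝 0)
  rOut_le : ∀ m, (ρ m).rOut ≤ 2 * (ρ m).rIn
  closedBall_subset : ∀ m, ∀ x ∈ T, Metric.closedBall x (ρ m).rOut ⊆ L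
  close : ∀ m, ∀ x ∈ T, ∀ y ∈ Metric.ball x (ρ m).rOut, dist (h y) (h x) ≤ δ / 2

namespace ComparisonData

variable {p : ℝ} {D T L : Set (EuclideanSpace ℝ (Fin n))}
  {h V χ : EuclideanSpace ℝ (Fin n) → ℝ}
  {G Q : EuclideanSpace ℝ (Fin n) → EuclideanSpace ℝ (Fin n)} {δ : ℝ}
  {ρ : ℕ → ContDiffBump (0 : EuclideanSpace ℝ (Fin n))}

theorem T_subset (d : ComparisonData p D T L h V χ G Q δ ρ) : T ⊆ L := fun x hx =>
  d.closedBall_subset 0 x hx (Metric.mem_closedBall_self (ρ 0).rOut_pos.le)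

theorem L_mem_nhds (d : ComparisonData p D T L h V χ G Q δ ρ) {x : EuclideanSpace ℝ (Fin n)}
    (hx : x ∈ T) : L ∈ 𝓝 x :=
  mem_of_superset (Metric.closedBall_mem_nhds x (ρ 0).rOut_pos) (d.closedBall_subset 0 x hx)

theorem χ_eq_zero (d : ComparisonData p D T L h V χ G Q δ ρ) {x : EuclideanSpace ℝ (Fin n)}
    (hx : x ∉ T) : χ x = 0 := image_eq_zero_of_notMem_tsupport fun h => hx (d.tsupport_χ h)

theorem integrable_h (d : ComparisonData p D T L h V χ G Q δ ρ) : Integrable (L.indicator h) :=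
  (integrable_indicator_iff d.isCompact_L.measurableSet).2
    ((d.continuousOn.mono d.L_subset).integrableOn_compact d.isCompact_L)

theorem memLp_G (d : ComparisonData p D T L h V χ G Q δ ρ) :
    MemLp G (ENNReal.ofReal p) (volume.restrict L) := d.memLp L d.L_subset d.isCompact_L

theorem integrable_G (d : ComparisonData p D T L h V χ G Q δ ρ) : Integrable (L.indicator G) := by
  have : IsFiniteMeasure (volume.restrict L) :=
    isFiniteMeasure_restrict.2 d.isCompact_L.measure_lt_top.ne
  exact (integrable_indicator_iff d.isCompact_L.measurableSet).2
    (d.memLp_G.integrable (by simpa using by linarith [d.two_le]))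

theorem integrable_norm_rpow (d : ComparisonData p D T L h V χ G Q δ ρ) :
    Integrable fun x => ‖L.indicator G x‖ ^ p := by
  have hp := d.two_le
  have h1 : (fun x => ‖L.indicator G x‖ ^ p) = L.indicator fun x => ‖G x‖ ^ p := by
    ext x
    by_cases hx : x ∈ L
    · simp [hx]
    · simp [hx, Real.zero_rpow (by linarith : p ≠ 0)]
  rw [h1, integrable_indicator_iff d.isCompact_L.measurableSet]
  have := d.memLp_G.integrable_norm_rpow (by simpa using by linarith) (by simp)
  rwa [ENNReal.toReal_ofReal (by linarith)] at this

/-- The mollified function. -/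
noncomputable def u (_ : ComparisonData p D T L h V χ G Q δ ρ) (m : ℕ) :
    EuclideanSpace ℝ (Fin n) → ℝ :=
  (ρ m).normed volume ⋆[lsmul ℝ ℝ, volume] L.indicator h

/-- The mollified gradient. -/
noncomputable def g (_ : ComparisonData p D T L h V χ G Q δ ρ) (m : ℕ) :
    EuclideanSpace ℝ (Fin n) → EuclideanSpace ℝ (Fin n) :=
  (ρ m).normed volume ⋆[lsmul ℝ ℝ, volume] L.indicator G

/-- The test function. -/
noncomputable def test (d : ComparisonData p D T L h V χ G Q δ ρ) (m : ℕ) :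
    EuclideanSpace ℝ (Fin n) → ℝ := fun x => χ x * expNegInvGlue (d.u m x - V x - δ)

/-- The weight in the gradient of the test function. -/
noncomputable def c (d : ComparisonData p D T L h V χ G Q δ ρ) (m : ℕ) :
    EuclideanSpace ℝ (Fin n) → ℝ := fun x => χ x * deriv expNegInvGlue (d.u m x - V x - δ)

theorem contDiff_u (d : ComparisonData p D T L h V χ G Q δ ρ) (m : ℕ) : ContDiff ℝ ∞ (d.u m) :=
  (ρ m).hasCompactSupport_normed.contDiff_convolution_left (n := ⊤) _ (ρ m).contDiff_normed
    d.integrable_h.locallyIntegrable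

theorem continuous_g (d : ComparisonData p D T L h V χ G Q δ ρ) (m : ℕ) : Continuous (d.g m) :=
  (ρ m).hasCompactSupport_normed.continuous_convolution_left _ (ρ m).continuous_normed
    d.integrable_G.locallyIntegrable

theorem abs_u_sub_le (d : ComparisonData p D T L h V χ G Q δ ρ) (m : ℕ)
    {x : EuclideanSpace ℝ (Fin n)} (hx : x ∈ T) : |d.u m x - h x| ≤ δ / 2 := by
  have h1 := (ρ m).dist_normed_convolution_le (μ := volume) (x₀ := x) (ε := δ / 2)
    d.integrable_h.aestronglyMeasurable fun y hy => by
      rw [indicator_of_mem (d.closedBall_subset m x hx (Metric.ball_subset_closedBall hy)),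
        indicator_of_mem (d.T_subset hx)]
      exact d.close m x hx y hy
  rwa [indicator_of_mem (d.T_subset hx), Real.dist_eq] at h1

theorem tendsto_u (d : ComparisonData p D T L h V χ G Q δ ρ) {x : EuclideanSpace ℝ (Fin n)}
    (hx : x ∈ T) : Tendsto (fun m => d.u m x) atTop (𝓝 (h x)) := by
  have h1 : Tendsto (L.indicator h) (𝓝 x) (𝓝 (h x)) := by
    have h2 : ContinuousAt h x :=
      d.continuousOn.continuousAt (mem_of_superset (d.L_mem_nhds hx) d.L_subset)
    refine h2.tendsto.congr' ?_
    filter_upwards [d.L_mem_nhds hx] with y hy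
    rw [indicator_of_mem hy]
  exact ContDiffBump.convolution_tendsto_right (g := fun _ => L.indicator h) (k := fun _ => x)
    d.rOut_tendsto (Eventually.of_forall fun _ => d.integrable_h.aestronglyMeasurable)
    (h1.comp tendsto_snd) tendsto_const_nhds

theorem ae_tendsto_g (d : ComparisonData p D T L h V χ G Q δ ρ) :
    ∀ᵐ x, Tendsto (fun m => d.g m x) atTop (𝓝 (L.indicator G x)) :=
  ContDiffBump.ae_convolution_tendsto_right_of_locallyIntegrable d.rOut_tendsto
    (Eventually.of_forall d.rOut_le) d.integrable_G.locallyIntegrable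

theorem fderiv_test (d : ComparisonData p D T L h V χ G Q δ ρ) (m : ℕ)
    (x v : EuclideanSpace ℝ (Fin n)) :
    fderiv ℝ (d.test m) x v = d.c m x * inner ℝ (d.g m x - Q x) v := by
  refine fderiv_mul_expNegInvGlue_apply d.smooth_χ d.tsupport_χ (d.contDiff_u m) d.smooth_V
    (fun x hx => ?_) (fun x hx v => ?_) d.fderiv_V x v
  -- Where `χ` is not locally `1`, `h - V ≤ δ / 2`; mollification moves `h` by at most another `δ /
  -- 2`, so the argument of `expNegInvGlue` is still nonpositive.
  · refine (d.cutoff x hx).imp_right fun h1 => ?_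
    have := (abs_le.1 (d.abs_u_sub_le m hx)).2
    linarith
  · exact fderiv_normed_convolution_of_isWeakGradient d.isOpen.measurableSet d.weakGradient
      d.L_subset d.integrable_h d.integrable_G (ρ m) (d.closedBall_subset m x hx) v

theorem contDiff_test (d : ComparisonData p D T L h V χ G Q δ ρ) (m : ℕ) :
    ContDiff ℝ ∞ (d.test m) :=
  d.smooth_χ.mul ((expNegInvGlue.contDiff (n := ⊤)).comp
    (((d.contDiff_u m).sub d.smooth_V).sub contDiff_const))

theorem hasCompactSupport_test (d : ComparisonData p D T L h V χ G Q δ ρ) (m : ℕ) :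
    HasCompactSupport (d.test m) :=
  HasCompactSupport.mul_right
    (d.isCompact_T.of_isClosed_subset (isClosed_tsupport χ) d.tsupport_χ)

theorem isTestFunction_test (d : ComparisonData p D T L h V χ G Q δ ρ) (m : ℕ) :
    IsTestFunction D (d.test m) :=
  ⟨d.contDiff_test m, d.hasCompactSupport_test m,
    (tsupport_mul_subset_left.trans d.tsupport_χ).trans (d.T_subset.trans d.L_subset)⟩

theorem c_eq_zero (d : ComparisonData p D T L h V χ G Q δ ρ) (m : ℕ)
    {x : EuclideanSpace ℝ (Fin n)} (hx : x ∉ T) : d.c m x = 0 := by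
  simp [c, d.χ_eq_zero hx]

theorem continuous_c (d : ComparisonData p D T L h V χ G Q δ ρ) (m : ℕ) : Continuous (d.c m) :=
  d.smooth_χ.continuous.mul
    (((expNegInvGlue.contDiff (n := ⊤)).continuous_deriv (by simp)).comp
      (((d.contDiff_u m).continuous.sub d.smooth_V.continuous).sub continuous_const))

/-- Uniform bounds on the support of the cutoff. -/
theorem exists_bound (d : ComparisonData p D T L h V χ G Q δ ρ) :
    ∃ B : ℝ, 0 ≤ B ∧ ∀ x ∈ T, ‖Q x‖ ≤ B ∧ ‖x‖ ≤ B ∧ ∀ m, |d.c m x| ≤ B ∧ |d.test m x| ≤ B := by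
  obtain ⟨B₁, hB₁⟩ := d.isCompact_T.exists_bound_of_continuousOn d.smooth_Q.continuous.continuousOn
  obtain ⟨B₂, hB₂⟩ := d.isCompact_T.exists_bound_of_continuousOn
    (f := fun x => x) continuousOn_id
  obtain ⟨M, hM⟩ := d.isCompact_T.exists_bound_of_continuousOn
    (f := fun x => h x - V x) ((d.continuousOn.mono (d.T_subset.trans d.L_subset)).sub
      d.smooth_V.continuous.continuousOn)
  -- On `T` the argument `u - V - δ` differs from `h - V` by at most `δ / 2 + δ`, so it stays in
  -- this interval for every `m`.
  obtain ⟨B₃, hB₃⟩ := (isCompact_Icc (a := -(M + 2 * δ)) (b := M + 2 * δ)).exists_bound_of_continuousOn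
    (((expNegInvGlue.contDiff (n := ⊤)).continuous_deriv (by simp)).continuousOn)
  obtain ⟨B₄, hB₄⟩ := (isCompact_Icc (a := -(M + 2 * δ)) (b := M + 2 * δ)).exists_bound_of_continuousOn
    ((expNegInvGlue.contDiff (n := ⊤)).continuous.continuousOn)
  refine ⟨max 0 (max (max B₁ B₂) (max B₃ B₄)), le_max_left _ _, fun x hx => ⟨?_, ?_, fun m => ?_⟩⟩
  · exact (hB₁ x hx).trans (by simp)
  · exact (hB₂ x hx).trans (by simp)
  · have h1 : d.u m x - V x - δ ∈ Icc (-(M + 2 * δ)) (M + 2 * δ) := by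
      have e1 := abs_le.1 (d.abs_u_sub_le m hx)
      have e2 := abs_le.1 (hM x hx)
      have := d.δ_pos
      constructor <;> linarith [e1.1, e1.2, e2.1, e2.2]
    have h2 : |χ x| ≤ 1 := abs_le.2 ⟨by linarith [(d.χ_mem x).1], (d.χ_mem x).2⟩
    have h3 : ∀ t B : ℝ, |t| ≤ B → |χ x * t| ≤ B := fun t B ht => by
      rw [abs_mul]
      nlinarith [abs_nonneg t, abs_nonneg (χ x)]
    exact ⟨(h3 _ _ (hB₃ _ h1)).trans (by simp), (h3 _ _ (hB₄ _ h1)).trans (by simp)⟩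

theorem norm_g_rpow_le (d : ComparisonData p D T L h V χ G Q δ ρ) (m : ℕ)
    (x : EuclideanSpace ℝ (Fin n)) : ‖d.g m x‖ ^ p ≤
      ((ρ m).normed volume ⋆[lsmul ℝ ℝ, volume] fun x => ‖L.indicator G x‖ ^ p) x :=
  norm_rpow_normed_convolution_le (by linarith [d.two_le]) (ρ m) d.integrable_G
    d.integrable_norm_rpow x

/-- The difference of the `p`-Laplace fluxes of `h` and `V`. -/
noncomputable def flux (_ : ComparisonData p D T L h V χ G Q δ ρ) :
    EuclideanSpace ℝ (Fin n) → EuclideanSpace ℝ (Fin n) := fun x =>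
  ‖L.indicator G x‖ ^ (p - 2) • L.indicator G x - ‖Q x‖ ^ (p - 2) • Q x

/-- The pointwise limit of the weights. -/
noncomputable def cLim (_ : ComparisonData p D T L h V χ G Q δ ρ) :
    EuclideanSpace ℝ (Fin n) → ℝ := fun x => χ x * deriv expNegInvGlue (h x - V x - δ)

theorem tendsto_c (d : ComparisonData p D T L h V χ G Q δ ρ) (x : EuclideanSpace ℝ (Fin n)) :
    Tendsto (fun m => d.c m x) atTop (𝓝 (d.cLim x)) := by
  by_cases hx : x ∈ T
  · have hc : Continuous (deriv expNegInvGlue) :=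
      (expNegInvGlue.contDiff (n := ⊤)).continuous_deriv (by simp)
    exact ((hc.tendsto _).comp
      (((d.tendsto_u hx).sub_const (V x)).sub_const δ)).const_mul (χ x)
  · simp [d.c_eq_zero _ hx, cLim, d.χ_eq_zero hx]

theorem tendsto_test (d : ComparisonData p D T L h V χ G Q δ ρ) (x : EuclideanSpace ℝ (Fin n)) :
    Tendsto (fun m => d.test m x) atTop (𝓝 (χ x * expNegInvGlue (h x - V x - δ))) := by
  by_cases hx : x ∈ T
  · have hc : Continuous expNegInvGlue := (expNegInvGlue.contDiff (n := ⊤)).continuous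
    exact ((hc.tendsto _).comp
      (((d.tendsto_u hx).sub_const (V x)).sub_const δ)).const_mul (χ x)
  · simp [test, d.χ_eq_zero hx]

theorem cLim_nonneg (d : ComparisonData p D T L h V χ G Q δ ρ) (x : EuclideanSpace ℝ (Fin n)) :
    0 ≤ d.cLim x := mul_nonneg (d.χ_mem x).1 expNegInvGlue.monotone.deriv_nonneg

theorem aestronglyMeasurable_flux (d : ComparisonData p D T L h V χ G Q δ ρ) :
    AEStronglyMeasurable d.flux := by
  have h1 := d.integrable_G.aestronglyMeasurable
  have h2 : Continuous fun x => ‖Q x‖ ^ (p - 2) • Q x :=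
    (d.smooth_Q.continuous.norm.rpow_const fun _ => Or.inr (by linarith [d.two_le])).smul
      d.smooth_Q.continuous
  refine AEStronglyMeasurable.sub ?_ h2.aestronglyMeasurable
  exact ((h1.norm.aemeasurable.pow_const (p - 2)).aestronglyMeasurable).smul h1

/-- The equation for `h` minus the supersolution inequality for `V`, both tested with `d.test m`,
whose gradient is `c (g - Q)`. -/
theorem integral_flux_nonpos (d : ComparisonData p D T L h V χ G Q δ ρ) (m : ℕ)
    (hi : Integrable fun x => d.c m x * inner ℝ (d.flux x) (d.g m x - Q x)) :
    ∫ x, d.c m x * inner ℝ (d.flux x) (d.g m x - Q x) ≤ 0 := by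
  have h1 := d.harmonic _ (d.isTestFunction_test m)
  have h2 := integral_nonneg_of_isDominative d.two_le d.smooth_Q d.hessian_le
    ((d.contDiff_test m).of_le (by simp)) (d.hasCompactSupport_test m)
    fun x => mul_nonneg (d.χ_mem x).1 (expNegInvGlue.nonneg _)
  rw [← integral_indicator d.isOpen.measurableSet] at h1
  have e : ∀ x, D.indicator (fun x => ‖G x‖ ^ (p - 2) * fderiv ℝ (d.test m) x (G x)) x =
      d.c m x * inner ℝ (d.flux x) (d.g m x - Q x) +
        ‖Q x‖ ^ (p - 2) * fderiv ℝ (d.test m) x (Q x) := by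
    intro x
    simp only [d.fderiv_test]
    by_cases hx : x ∈ T
    · have hL := d.T_subset hx
      rw [indicator_of_mem (d.L_subset hL)]
      simp only [flux, indicator_of_mem hL, inner_sub_left, inner_smul_left]
      simp only [inner_sub_right, RCLike.conj_to_real]
      rw [real_inner_comm (G x) (d.g m x), real_inner_comm (G x) (Q x),
        real_inner_comm (Q x) (d.g m x)]
      ring
    · by_cases hD : x ∈ D <;> simp [d.c_eq_zero m hx, hD]
  have hi2 : Integrable fun x => ‖Q x‖ ^ (p - 2) * fderiv ℝ (d.test m) x (Q x) := by
    refine Continuous.integrable_of_hasCompactSupport ?_ ?_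
    · exact (d.smooth_Q.continuous.norm.rpow_const fun _ => Or.inr (by linarith [d.two_le])).mul
        (((d.contDiff_test m).continuous_fderiv (by simp)).clm_apply d.smooth_Q.continuous)
    · refine HasCompactSupport.of_support_subset_isCompact d.isCompact_T fun x hx => ?_
      by_contra hxT
      exact hx (by simp [d.fderiv_test, d.c_eq_zero m hxT])
  simp only [e] at h1
  rw [integral_add hi hi2] at h1
  linarith

/-- In the limit `m → ∞` of `integral_flux_nonpos` the integrand becomes nonnegative by monotonicity
of the flux. Hence it vanishes almost everywhere, and strictness forces the two gradients to agree
wherever the weight is nonzero. -/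
theorem cLim_smul_eq_zero (d : ComparisonData p D T L h V χ G Q δ ρ) :
    ∀ᵐ x, d.cLim x • (L.indicator G x - Q x) = 0 := by
  obtain ⟨B, hB0, hB⟩ := d.exists_bound
  have hp := d.two_le
  have key : Integrable (fun x => d.cLim x * inner ℝ (d.flux x) (L.indicator G x - Q x)) ∧
      ∫ x, d.cLim x * inner ℝ (d.flux x) (L.indicator G x - Q x) ≤ 0 := by
    refine integral_nonpos_of_le_normed_convolution d.rOut_tendsto d.rOut_le
      -- `B` bounds the weight, `4` comes from `rpow_sub_one_add_mul_add_le`, and `1 + B ^ p`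
      -- absorbs the `p`-th power of the bound on `Q`.
      d.isCompact_T d.integrable_norm_rpow (C := B * (4 * (1 + B ^ p)))
      (f := fun m x => d.c m x * inner ℝ (d.flux x) (d.g m x - Q x)) ?_ ?_ ?_
      d.integral_flux_nonpos
    · exact fun m => (d.continuous_c m).aestronglyMeasurable.mul
        (d.aestronglyMeasurable_flux.inner
          ((d.continuous_g m).sub d.smooth_Q.continuous).aestronglyMeasurable)
    · intro m x
      have hΓ : 0 ≤ ‖L.indicator G x‖ ^ p := by positivity
      have hg := d.norm_g_rpow_le m x
      have hg0 : 0 ≤ ‖d.g m x‖ ^ p := by positivity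
      have hBp : 0 ≤ B ^ p := by positivity
      by_cases hx : x ∈ T
      · obtain ⟨b1, -, b3⟩ := hB x hx
        have e1 : ∀ a : EuclideanSpace ℝ (Fin n), ‖‖a‖ ^ (p - 2) • a‖ = ‖a‖ ^ (p - 1) := by
          intro a
          rw [norm_smul, Real.norm_of_nonneg (by positivity),
            ← Real.rpow_add_one' (norm_nonneg _) (by linarith)]
          congr 1
          ring
        have e2 : ‖d.flux x‖ ≤ ‖L.indicator G x‖ ^ (p - 1) + B ^ (p - 1) := by
          refine (norm_sub_le _ _).trans ?_
          rw [e1, e1]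
          gcongr
          linarith
        have e3 : ‖d.g m x - Q x‖ ≤ ‖d.g m x‖ + B := (norm_sub_le _ _).trans (by linarith)
        have e4 : |inner ℝ (d.flux x) (d.g m x - Q x)| ≤
            4 * (‖L.indicator G x‖ ^ p + ‖d.g m x‖ ^ p + B ^ p) :=
          (abs_real_inner_le_norm _ _).trans ((mul_le_mul e2 e3 (norm_nonneg _)
            (by positivity)).trans (rpow_sub_one_add_mul_add_le (by linarith) (norm_nonneg _)
              (norm_nonneg _) hB0))
        rw [abs_mul, indicator_of_mem hx, Pi.one_apply, mul_assoc B]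
        refine mul_le_mul (b3 m).1 (e4.trans ?_) (abs_nonneg _) hB0
        rw [mul_assoc]
        refine mul_le_mul_of_nonneg_left ?_ (by norm_num)
        nlinarith
      · rw [d.c_eq_zero m hx, zero_mul, abs_zero, indicator_of_notMem hx]
        have : 0 ≤ ((ρ m).normed volume ⋆[lsmul ℝ ℝ, volume] fun x => ‖L.indicator G x‖ ^ p) x :=
          hg0.trans hg
        positivity
    · filter_upwards [d.ae_tendsto_g] with x hx
      exact (d.tendsto_c x).mul (tendsto_const_nhds.inner (hx.sub_const (Q x)))
  obtain ⟨hI, hle⟩ := key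
  have h0 : ∀ x, 0 ≤ d.cLim x * inner ℝ (d.flux x) (L.indicator G x - Q x) := fun x =>
    mul_nonneg (d.cLim_nonneg x) (rpow_norm_smul_sub_inner_nonneg hp _ _)
  have h1 := (integral_eq_zero_iff_of_nonneg h0 hI).1
    (le_antisymm hle (integral_nonneg h0))
  filter_upwards [h1] with x hx
  rcases mul_eq_zero.1 hx with h2 | h2
  · simp [h2]
  · simp [eq_of_rpow_norm_smul_sub_inner_eq_zero hp h2]

/-- A substitute for the Poincaré inequality. The derivative of `⟨x, e⟩ * test` along the unit
vector `e` is `test` plus `⟨x, e⟩` times the derivative of `test`, and has integral zero; the second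
summand tends to zero almost everywhere by `cLim_smul_eq_zero`. -/
theorem integral_limit_nonpos (d : ComparisonData p D T L h V χ G Q δ ρ)
    {e : EuclideanSpace ℝ (Fin n)} (he : ‖e‖ = 1) :
    Integrable (fun x => χ x * expNegInvGlue (h x - V x - δ)) ∧
      ∫ x, χ x * expNegInvGlue (h x - V x - δ) ≤ 0 := by
  obtain ⟨B, hB0, hB⟩ := d.exists_bound
  have hp := d.two_le
  have hcontf : ∀ m, Continuous fun x =>
      d.test m x + inner ℝ x e * (d.c m x * inner ℝ (d.g m x - Q x) e) := fun m =>
    (d.contDiff_test m).continuous.add ((continuous_id.inner continuous_const).mul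
      ((d.continuous_c m).mul (((d.continuous_g m).sub d.smooth_Q.continuous).inner
        continuous_const)))
  refine integral_nonpos_of_le_normed_convolution d.rOut_tendsto d.rOut_le
    d.isCompact_T d.integrable_norm_rpow (C := B + B * B * (1 + B))
    (f := fun m x => d.test m x + inner ℝ x e * (d.c m x * inner ℝ (d.g m x - Q x) e))
    (fun m => (hcontf m).aestronglyMeasurable) ?_ ?_ ?_
  · intro m x
    have hΓ : 0 ≤ ‖L.indicator G x‖ ^ p := by positivity
    have hg := d.norm_g_rpow_le m x
    have hg0 : 0 ≤ ‖d.g m x‖ ^ p := by positivity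
    by_cases hx : x ∈ T
    · obtain ⟨b1, b2, b3⟩ := hB x hx
      -- Only a first power of the gradient occurs here; this bound lets the `p`-th power majorant
      -- serve again.
      have e0 : ‖d.g m x‖ ≤ 1 + ‖d.g m x‖ ^ p := by
        rcases le_total ‖d.g m x‖ 1 with h1 | h1
        · linarith
        · have := Real.rpow_le_rpow_of_exponent_le h1 (by linarith : (1 : ℝ) ≤ p)
          rw [Real.rpow_one] at this
          linarith
      have e1 : |inner ℝ (d.g m x - Q x) e| ≤ ‖d.g m x‖ + B := by
        refine (abs_real_inner_le_norm _ _).trans ?_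
        rw [he, mul_one]
        exact (norm_sub_le _ _).trans (by linarith)
      have e2 : |inner ℝ x e| ≤ B := by
        refine (abs_real_inner_le_norm _ _).trans ?_
        rw [he, mul_one]
        exact b2
      have e3 : |inner ℝ x e * (d.c m x * inner ℝ (d.g m x - Q x) e)| ≤
          B * (B * (‖d.g m x‖ + B)) := by
        rw [abs_mul, abs_mul]
        exact mul_le_mul e2 (mul_le_mul (b3 m).1 e1 (abs_nonneg _) hB0) (by positivity) hB0
      rw [indicator_of_mem hx, Pi.one_apply]
      refine (abs_add_le _ _).trans ((add_le_add (b3 m).2 e3).trans ?_)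
      set s := ((ρ m).normed volume ⋆[lsmul ℝ ℝ, volume] fun x => ‖L.indicator G x‖ ^ p) x
      have e4 : ‖d.g m x‖ + B ≤ (1 + B) * (1 + ‖L.indicator G x‖ ^ p + s) := by
        nlinarith
      have e5 : B ≤ B * (1 + ‖L.indicator G x‖ ^ p + s) := by nlinarith
      have e6 := mul_le_mul_of_nonneg_left e4 (mul_nonneg hB0 hB0)
      nlinarith
    · rw [d.c_eq_zero m hx, indicator_of_notMem hx]
      have : 0 ≤ ((ρ m).normed volume ⋆[lsmul ℝ ℝ, volume] fun x => ‖L.indicator G x‖ ^ p) x :=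
        hg0.trans hg
      simp only [test, d.χ_eq_zero hx, zero_mul, mul_zero, add_zero, abs_zero]
      positivity
  · filter_upwards [d.ae_tendsto_g, d.cLim_smul_eq_zero] with x hx hx0
    have h1 := (d.tendsto_test x).add (((d.tendsto_c x).mul
      ((hx.sub_const (Q x)).inner (tendsto_const_nhds (x := e)))).const_mul (inner ℝ x e))
    have h2 : d.cLim x * inner ℝ (L.indicator G x - Q x) e = 0 := by
      rw [← real_inner_smul_left, hx0, inner_zero_left]
    rwa [h2, mul_zero, add_zero] at h1
  · intro m _
    refine le_of_eq ?_
    have hC : ContDiff ℝ 1 fun x => inner ℝ x e * d.test m x :=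
      (contDiff_id.inner ℝ contDiff_const).mul ((d.contDiff_test m).of_le (by simp))
    rw [← integral_fderiv_eq_zero volume hC (d.hasCompactSupport_test m).mul_left e]
    refine integral_congr_ae (Eventually.of_forall fun x => ?_)
    have h1 : HasFDerivAt (fun x : EuclideanSpace ℝ (Fin n) => inner ℝ x e) (innerSL ℝ e) x := by
      simpa [real_inner_comm] using (innerSL ℝ e).hasFDerivAt (x := x)
    have h2 := h1.mul ((d.contDiff_test m).differentiable (by simp) x).hasFDerivAt
    simp only
    rw [show fderiv ℝ (fun x => inner ℝ x e * d.test m x) x = _ from h2.fderiv]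
    simp [d.fderiv_test, he]
    ring

end ComparisonData

end Comparison

/-- Smooth functions whose Hessian is everywhere dominative. -/
def IsSmoothDominative {n : ℕ} (p : ℝ) (V : EuclideanSpace ℝ (Fin n) → ℝ) : Prop :=
  ContDiff ℝ ∞ V ∧ ∃ Q : EuclideanSpace ℝ (Fin n) → EuclideanSpace ℝ (Fin n),
    ContDiff ℝ 1 Q ∧ (∀ x v, fderiv ℝ V x v = inner ℝ (Q x) v) ∧
      ∀ x, IsDominative p (fderiv ℝ Q x)

/-- Comparison principle between a `p`-harmonic function and a smooth dominative function. -/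
theorem IsPHarmonic.le_of_isSmoothDominative {n : ℕ} (hn : 0 < n) {p : ℝ} (hp : 2 ≤ p)
    {D : Set (EuclideanSpace ℝ (Fin n))} (hD : IsOpen D) (hDb : Bornology.IsBounded D)
    {h V : EuclideanSpace ℝ (Fin n) → ℝ} (hc : ContinuousOn h (closure D))
    (hh : IsPHarmonic p D h) (hV : IsSmoothDominative p V)
    (hle : ∀ x ∈ frontier D, h x ≤ V x) : ∀ x ∈ D, h x ≤ V x := by
  obtain ⟨hVC, Q, hQC, hVQ, hdom⟩ := hV
  obtain ⟨hcD, -, G, hGp, hG, hharm⟩ := hh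
  intro x₀ hx₀
  by_contra! hlt
  set δ := (h x₀ - V x₀) / 2 with hδ
  have hδ0 : 0 < δ := by linarith
  have hcc : IsCompact (closure D) := hDb.isCompact_closure
  -- This set avoids `∂D`, where `h - V ≤ 0`, so it is a compact subset of `D` and admits a cutoff.
  set S := closure D ∩ (fun x => h x - V x) ⁻¹' Ici (δ / 2) with hS
  have hSc : IsCompact S := hcc.of_isClosed_subset
    ((hc.sub hVC.continuous.continuousOn).preimage_isClosed_of_isClosed isClosed_closure
      isClosed_Ici) inter_subset_left
  have hSD : S ⊆ D := by
    intro x hx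
    by_contra hxD
    have h1 := hle x ⟨hx.1, fun h2 => hxD (interior_subset h2)⟩
    have h2 : δ / 2 ≤ h x - V x := hx.2
    linarith
  obtain ⟨χ, T, hχ, hT, hTD, hχT, hχS, hχ01⟩ := exists_smooth_cutoff hSc hD hSD
  obtain ⟨r, hr, hrD⟩ := hT.exists_cthickening_subset_open hD hTD
  have hLc : IsCompact (Metric.cthickening r T) := hT.cthickening
  have hu := hLc.uniformContinuousOn_of_continuous (hcD.mono hrD)
  obtain ⟨R, hR, hRh⟩ := Metric.uniformContinuousOn_iff.1 hu (δ / 2) (by linarith)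
  -- Radii up to `r` keep the mollification inside `D`; radii up to `R` keep the oscillation of `h`
  -- below `δ / 2`.
  set r₁ := min r R with hr₁
  have hr₁0 : 0 < r₁ := lt_min hr hR
  have hmpos : ∀ m : ℕ, 0 < r₁ / ((m : ℝ) + 1) := fun m => by positivity
  have hmle : ∀ m : ℕ, r₁ / ((m : ℝ) + 1) ≤ r₁ := fun m =>
    div_le_self hr₁0.le (by linarith [m.cast_nonneg (α := ℝ)])
  let ρ : ℕ → ContDiffBump (0 : EuclideanSpace ℝ (Fin n)) := fun m =>
    ⟨r₁ / ((m : ℝ) + 1) / 2, r₁ / ((m : ℝ) + 1), by linarith [hmpos m], by linarith [hmpos m]⟩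
  have hball : ∀ m, ∀ x ∈ T, Metric.closedBall x (ρ m).rOut ⊆ Metric.cthickening r T := by
    intro m x hx
    exact (Metric.closedBall_subset_closedBall ((hmle m).trans (min_le_left _ _))).trans
      (Metric.closedBall_subset_cthickening hx r)
  have d : ComparisonData p D T (Metric.cthickening r T) h V χ G Q δ ρ :=
    { two_le := hp
      isOpen := hD
      isCompact_T := hT
      isCompact_L := hLc
      L_subset := hrD
      continuousOn := hcD
      memLp := hGp
      weakGradient := hG
      harmonic := hharm
      smooth_V := hVC
      smooth_Q := hQC
      fderiv_V := hVQ
      hessian_le := hdom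
      smooth_χ := hχ
      tsupport_χ := hχT
      χ_mem := hχ01
      cutoff := fun x hx => by
        by_cases h1 : δ / 2 ≤ h x - V x
        · exact Or.inl (hχS x ⟨subset_closure (hTD hx), h1⟩)
        · exact Or.inr (not_le.1 h1).le
      δ_pos := hδ0
      rOut_tendsto := tendsto_const_div_atTop_nhds_zero_nat r₁ |>.comp (tendsto_add_atTop_nat 1)
        |>.congr fun m => by simp [ρ]
      rOut_le := fun m => by simp only [ρ]; linarith
      closedBall_subset := hball
      close := fun m x hx y hy => by
        have h1 : dist y x < R := lt_of_lt_of_le hy ((hmle m).trans (min_le_right _ _))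
        exact (hRh y (hball m x hx (Metric.ball_subset_closedBall hy)) x
          (Metric.self_subset_cthickening T hx) h1).le }
  obtain ⟨hI, hint⟩ := d.integral_limit_nonpos
    (e := EuclideanSpace.single (⟨0, hn⟩ : Fin n) (1 : ℝ)) (by simp)
  have h0 : ∀ x, 0 ≤ χ x * expNegInvGlue (h x - V x - δ) := fun x =>
    mul_nonneg (hχ01 x).1 (expNegInvGlue.nonneg _)
  have h1 := (integral_eq_zero_iff_of_nonneg h0 hI).1 (le_antisymm hint (integral_nonneg h0))
  have hx₀S : x₀ ∈ S := ⟨subset_closure hx₀, by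
    show δ / 2 ≤ h x₀ - V x₀
    linarith⟩
  have h2 : ∀ᶠ x in 𝓝 x₀, 0 < h x - V x - δ := by
    have h3 : ContinuousAt (fun x => h x - V x - δ) x₀ :=
      ((hcD.continuousAt (hD.mem_nhds hx₀)).sub hVC.continuous.continuousAt).sub
        continuousAt_const
    exact h3.eventually (lt_mem_nhds (by linarith : 0 < h x₀ - V x₀ - δ))
  have h3 : ∀ᶠ x in 𝓝 x₀, ¬ (χ x * expNegInvGlue (h x - V x - δ) = 0) := by
    filter_upwards [h2, hχS x₀ hx₀S] with x hx1 hx2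
    rw [hx2, one_mul]
    exact (expNegInvGlue.pos_of_pos hx1).ne'
  have h4 := Measure.measure_pos_of_mem_nhds
    (volume : Measure (EuclideanSpace ℝ (Fin n))) h3
  exact h4.ne' (ae_iff.1 h1)

/-! ### The cone of dominative functions and the regularized fundamental solution. -/

section Dominative

variable {n : ℕ} {p : ℝ}

theorem stdTrace_add (S T : EuclideanSpace ℝ (Fin n) →L[ℝ] EuclideanSpace ℝ (Fin n)) :
    stdTrace (S + T) = stdTrace S + stdTrace T := by
  simp [stdTrace, inner_add_left, Finset.sum_add_distrib]

/-- For fixed `u` and `κ` the defining inequality is linear in the operator. The superposition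
principle rests on this. -/
theorem IsDominative.add {S T : EuclideanSpace ℝ (Fin n) →L[ℝ] EuclideanSpace ℝ (Fin n)}
    (hS : IsDominative p S) (hT : IsDominative p T) : IsDominative p (S + T) := by
  intro u κ hκ
  have h1 := hS u κ hκ
  have h2 := hT u κ hκ
  rw [stdTrace_add, add_apply, inner_add_left]
  linarith

theorem IsSmoothDominative.add {V W : EuclideanSpace ℝ (Fin n) → ℝ}
    (hV : IsSmoothDominative p V) (hW : IsSmoothDominative p W) :
    IsSmoothDominative p fun x => V x + W x := by
  obtain ⟨hV, Q, hQ, hVQ, hdV⟩ := hV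
  obtain ⟨hW, R, hR, hWR, hdW⟩ := hW
  refine ⟨hV.add hW, fun x => Q x + R x, hQ.add hR, fun x v => ?_, fun x => ?_⟩
  · rw [fderiv_fun_add (hV.differentiable (by simp) x) (hW.differentiable (by simp) x), add_apply,
      hVQ, hWR, inner_add_left]
  · rw [fderiv_fun_add (hQ.differentiable one_ne_zero x) (hR.differentiable one_ne_zero x)]
    exact (hdV x).add (hdW x)

theorem isSmoothDominative_affine (l : EuclideanSpace ℝ (Fin n) →L[ℝ] ℝ) (b : ℝ) :
    IsSmoothDominative p fun x => l x + b := by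
  refine ⟨l.contDiff.add contDiff_const,
    fun _ => (InnerProductSpace.toDual ℝ (EuclideanSpace ℝ (Fin n))).symm l, contDiff_const,
    fun x v => ?_, fun x u κ _ => ?_⟩
  · rw [fderiv_add_const, l.fderiv]
    simp
  · simp [stdTrace]

theorem isSmoothDominative_sum {V : ℕ → EuclideanSpace ℝ (Fin n) → ℝ}
    (hV : ∀ i, IsSmoothDominative p (V i)) (N : ℕ) :
    IsSmoothDominative p fun x => ∑ i ∈ Finset.range N, V i x := by
  induction N with
  | zero => simpa using isSmoothDominative_affine (n := n) (p := p) 0 0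
  | succ N ih =>
    simp only [Finset.sum_range_succ]
    exact ih.add (hV N)

/-- The regularized fundamental solution `a (|x - y|² + ε)^{-s/2}`, `s = (n - p) / (p - 1)`, has
dominative Hessian. -/
theorem isSmoothDominative_fundamental (hp : 2 ≤ p) (hpn : p < n) {a : ℝ} (ha : 0 ≤ a)
    (y : EuclideanSpace ℝ (Fin n)) {ε : ℝ} (hε : 0 < ε) :
    IsSmoothDominative p fun x => a * (‖x - y‖ ^ 2 + ε) ^ (-(((n : ℝ) - p) / (p - 1) / 2)) := by
  set s := ((n : ℝ) - p) / (p - 1) with hs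
  have hs0 : 0 ≤ s := div_nonneg (by linarith) (by linarith)
  have hsp : s * (p - 1) = n - p := div_mul_cancel₀ _ (by linarith)
  set r : EuclideanSpace ℝ (Fin n) → ℝ := fun x => ‖x - y‖ ^ 2 + ε with hr
  have hr0 : ∀ x, 0 < r x := fun x => by positivity
  have hrC : ∀ {k : WithTop ℕ∞}, ContDiff ℝ k r := fun {k} =>
    ((contDiff_id.sub contDiff_const).norm_sq ℝ).add contDiff_const
  have hrd : ∀ x, HasFDerivAt r (2 • (innerSL ℝ (x - y))) x := fun x => by
    have := (((hasFDerivAt_id (𝕜 := ℝ) x).sub_const y).norm_sq).add_const ε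
    rwa [ContinuousLinearMap.comp_id] at this
  set t := -(s / 2) with ht
  set A : EuclideanSpace ℝ (Fin n) → ℝ := fun x => -(a * s) * r x ^ (t - 1) with hA
  have hAC : ContDiff ℝ 1 A := contDiff_const.mul (hrC.rpow_const_of_ne fun x => (hr0 x).ne')
  have hQC : ContDiff ℝ 1 fun x => A x • (x - y) := hAC.smul (contDiff_id.sub contDiff_const)
  refine ⟨contDiff_const.mul (hrC.rpow_const_of_ne fun x => (hr0 x).ne'),
    fun x => A x • (x - y), hQC, fun x v => ?_, fun x u κ hκ => ?_⟩
  · have h1 := ((hrd x).rpow_const (p := t) (Or.inl (hr0 x).ne')).const_mul a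
    rw [h1.fderiv]
    simp only [smul_apply, innerSL_apply_apply, smul_eq_mul, nsmul_eq_mul, real_inner_smul_left,
      hA, ht]
    push_cast
    ring
  · have h1 := ((hrd x).rpow_const (p := t - 1) (Or.inl (hr0 x).ne')).const_mul (-(a * s))
    have h2 := h1.smul ((hasFDerivAt_id (𝕜 := ℝ) x).sub_const y)
    set z := x - y with hz
    set m := r x ^ (t - 1 - 1) with hm
    have hm0 : 0 ≤ m := Real.rpow_nonneg (hr0 x).le _
    have hmr : r x ^ (t - 1) = m * r x := by
      rw [hm, Real.rpow_sub_one (hr0 x).ne' (t - 1), div_mul_cancel₀ _ (hr0 x).ne']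
    -- The Hessian is a nonpositive multiple of `r I - (s + 2) z ⊗ z`; what remains is to show that
    -- the dominative expression of this matrix is nonnegative.
    have hT : ∀ v, fderiv ℝ (fun x => A x • (x - y)) x v =
        (-(a * s) * m) • (r x • v - ((s + 2) * inner ℝ z v) • z) := by
      intro v
      rw [show fderiv ℝ (fun x => A x • (x - y)) x = _ from h2.fderiv]
      simp only [add_apply, smul_apply, ContinuousLinearMap.smulRight_apply,
        ContinuousLinearMap.id_apply, id_eq, innerSL_apply_apply, smul_eq_mul, nsmul_eq_mul, hmr]
      rw [← hz, ht]
      push_cast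
      module
    have htr : stdTrace (fderiv ℝ (fun x => A x • (x - y)) x) =
        -(a * s) * m * (n * r x - (s + 2) * ‖z‖ ^ 2) := by
      have e1 : ‖z‖ ^ 2 = ∑ j, inner ℝ z (EuclideanSpace.basisFun (Fin n) ℝ j) *
          inner ℝ z (EuclideanSpace.basisFun (Fin n) ℝ j) := by
        have := sum_basisFun_mul_inner (innerSL ℝ z) z
        simp only [innerSL_apply_apply] at this
        rw [this, real_inner_self_eq_norm_sq]
      have e2 : (n : ℝ) = ∑ _j : Fin n, (1 : ℝ) := by simp
      unfold stdTrace
      rw [e1, e2, Finset.mul_sum, Finset.sum_mul, ← Finset.sum_sub_distrib, Finset.mul_sum]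
      refine Finset.sum_congr rfl fun j _ => ?_
      rw [hT, real_inner_smul_left, inner_sub_left, real_inner_smul_left, real_inner_smul_left,
        real_inner_self_eq_norm_sq, (EuclideanSpace.basisFun (Fin n) ℝ).norm_eq_one]
      ring
    rw [htr, hT, real_inner_smul_left, inner_sub_left, real_inner_smul_left, real_inner_smul_left,
      real_inner_self_eq_norm_sq]
    have hcs : inner ℝ z u * inner ℝ z u ≤ ‖z‖ ^ 2 * ‖u‖ ^ 2 := by
      have := real_inner_mul_inner_self_le z u
      simpa [real_inner_self_eq_norm_sq] using this
    have hrx : r x = ‖z‖ ^ 2 + ε := rfl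
    -- Since `s (p - 1) = n - p`, the difference `n (p - 1) - (s + 2) (p - 1)` equals `(p - 2) (n -
    -- 1)`.
    have hns : s + 2 ≤ n := by
      have : (s + 2) * (p - 1) ≤ n * (p - 1) := by nlinarith
      exact le_of_mul_le_mul_right this (by linarith)
    have k1 : 0 ≤ κ * (n * r x - (s + 2) * ‖z‖ ^ 2) := by
      refine mul_nonneg hκ ?_
      rw [hrx]
      nlinarith [sq_nonneg ‖z‖, mul_nonneg (sub_nonneg.2 hns) (sq_nonneg ‖z‖),
        mul_nonneg (n.cast_nonneg (α := ℝ)) hε.le]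
    have k2 : 0 ≤ ‖u‖ ^ 2 * ((n + p - 2) * ε) := by
      have : (0 : ℝ) ≤ n + p - 2 := by linarith
      positivity
    have k3 : 0 ≤ (p - 2) * (s + 2) * (‖z‖ ^ 2 * ‖u‖ ^ 2 - inner ℝ z u * inner ℝ z u) :=
      mul_nonneg (mul_nonneg (by linarith) (by linarith)) (by linarith)
    have k4 : 0 ≤ (‖u‖ ^ 2 + κ) * (n * r x - (s + 2) * ‖z‖ ^ 2) +
        (p - 2) * (r x * ‖u‖ ^ 2 - (s + 2) * inner ℝ z u * inner ℝ z u) := by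
      -- The last summand vanishes precisely for the exponent `s = (n - p) / (p - 1)`. The others
      -- are nonnegative: the trace term by `s + 2 ≤ n`, the regularization term by `ε > 0`, and the
      -- third by Cauchy–Schwarz.
      have e : (‖u‖ ^ 2 + κ) * (n * r x - (s + 2) * ‖z‖ ^ 2) +
          (p - 2) * (r x * ‖u‖ ^ 2 - (s + 2) * inner ℝ z u * inner ℝ z u) =
          κ * (n * r x - (s + 2) * ‖z‖ ^ 2) + ‖u‖ ^ 2 * ((n + p - 2) * ε) +
          (p - 2) * (s + 2) * (‖z‖ ^ 2 * ‖u‖ ^ 2 - inner ℝ z u * inner ℝ z u) +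
          ‖u‖ ^ 2 * ‖z‖ ^ 2 * (n - p - s * (p - 1)) := by
        rw [hrx]
        ring
      rw [e, hsp]
      linarith
    have k5 := mul_nonneg (mul_nonneg (mul_nonneg ha hs0) hm0) k4
    linarith

end Dominative

/-! ### Approximation of the series from below by regularized partial sums. -/

section Series

variable {n : ℕ} {p : ℝ}

/-- The regularized partial sums of the series of fundamental solutions. -/
noncomputable def regularizedSum (p : ℝ) (a : ℕ → ℝ) (y : ℕ → EuclideanSpace ℝ (Fin n)) (N : ℕ)
    (x : EuclideanSpace ℝ (Fin n)) : ℝ :=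
  ∑ i ∈ Finset.range N,
    a i * (‖x - y i‖ ^ 2 + 1 / ((N : ℝ) + 1)) ^ (-(((n : ℝ) - p) / (p - 1) / 2))

theorem isSmoothDominative_regularizedSum (hp : 2 ≤ p) (hpn : p < n) {a : ℕ → ℝ}
    (ha : ∀ i, 0 ≤ a i) (y : ℕ → EuclideanSpace ℝ (Fin n)) (N : ℕ) :
    IsSmoothDominative p (regularizedSum p a y N) :=
  isSmoothDominative_sum (fun i => isSmoothDominative_fundamental hp hpn (ha i) (y i)
    (by positivity)) N

/-- Raising `N` adds nonnegative terms and also shrinks the regularization `1 / (N + 1)`, which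
increases each term because the exponent is nonpositive. -/
theorem monotone_regularizedSum (hp : 2 ≤ p) (hpn : p < n) {a : ℕ → ℝ}
    (ha : ∀ i, 0 ≤ a i) (y : ℕ → EuclideanSpace ℝ (Fin n)) (x : EuclideanSpace ℝ (Fin n)) :
    Monotone fun N => regularizedSum p a y N x := by
  have hs : 0 ≤ ((n : ℝ) - p) / (p - 1) / 2 :=
    div_nonneg (div_nonneg (by linarith) (by linarith)) (by norm_num)
  intro N M hNM
  refine (Finset.sum_le_sum fun i _ => mul_le_mul_of_nonneg_left
    (Real.rpow_le_rpow_of_nonpos (by positivity) ?_ (neg_nonpos.2 hs)) (ha i)).trans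
    (Finset.sum_le_sum_of_subset_of_nonneg (Finset.range_mono hNM) fun i _ _ =>
      mul_nonneg (ha i) (by positivity))
  have : (N : ℝ) ≤ M := by exact_mod_cast hNM
  gcongr

theorem ofReal_mul_rpow_le {a r ε s : ℝ} (ha : 0 ≤ a) (hr : 0 ≤ r) (hε : 0 < ε) (hs : 0 < s) :
    ENNReal.ofReal (a * (r ^ 2 + ε) ^ (-(s / 2))) ≤ ENNReal.ofReal a / ENNReal.ofReal r ^ s := by
  rcases hr.eq_or_lt with rfl | hr
  · rcases ha.eq_or_lt with rfl | ha
    · simp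
    · rw [ENNReal.ofReal_zero, ENNReal.zero_rpow_of_pos hs, ENNReal.div_zero (by simpa using ha)]
      exact le_top
  · rw [ENNReal.ofReal_rpow_of_pos hr, ← ENNReal.ofReal_div_of_pos (by positivity)]
    refine ENNReal.ofReal_le_ofReal ?_
    rw [div_eq_mul_inv a (r ^ s), ← Real.rpow_neg hr.le]
    refine mul_le_mul_of_nonneg_left ?_ ha
    have : r ^ (-s) = (r ^ 2) ^ (-(s / 2)) := by
      rw [← Real.rpow_natCast, ← Real.rpow_mul hr.le]
      congr 1
      push_cast
      ring
    rw [this]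
    exact Real.rpow_le_rpow_of_nonpos (by positivity) (by linarith) (by linarith)

theorem tendsto_ofReal_mul_rpow {a r s : ℝ} (ha : 0 ≤ a) (hr : 0 ≤ r) (hs : 0 < s) :
    Tendsto (fun N : ℕ => ENNReal.ofReal (a * (r ^ 2 + 1 / ((N : ℝ) + 1)) ^ (-(s / 2)))) atTop
      (𝓝 (ENNReal.ofReal a / ENNReal.ofReal r ^ s)) := by
  have hlim : Tendsto (fun N : ℕ => 1 / ((N : ℝ) + 1)) atTop (𝓝 0) :=
    tendsto_one_div_add_atTop_nhds_zero_nat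
  rcases hr.eq_or_lt with rfl | hr
  · rcases ha.eq_or_lt with rfl | ha
    · simp
    -- At the pole the regularized term is `a (N + 1)^(s/2)`, which tends to infinity.
    · rw [ENNReal.ofReal_zero, ENNReal.zero_rpow_of_pos hs, ENNReal.div_zero (by simpa using ha)]
      refine ENNReal.tendsto_ofReal_nhds_top.2 ?_
      refine Tendsto.const_mul_atTop ha ?_
      have h1 : Tendsto (fun N : ℕ => ((N : ℝ) + 1) ^ (s / 2)) atTop atTop :=
        (tendsto_rpow_atTop (by positivity)).comp
          (tendsto_atTop_add_const_right _ 1 tendsto_natCast_atTop_atTop)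
      refine h1.congr fun N => ?_
      have : (0 : ℝ) < (N : ℝ) + 1 := by positivity
      rw [Real.rpow_neg (by positivity), ← Real.inv_rpow (by positivity)]
      congr 1
      simp
  · rw [ENNReal.ofReal_rpow_of_pos hr, ← ENNReal.ofReal_div_of_pos (by positivity)]
    refine (ENNReal.continuous_ofReal.tendsto _).comp ?_
    have h1 : a / r ^ s = a * (r ^ 2 + 0) ^ (-(s / 2)) := by
      rw [div_eq_mul_inv a (r ^ s), ← Real.rpow_neg hr.le, add_zero, ← Real.rpow_natCast,
        ← Real.rpow_mul hr.le]
      congr 2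
      push_cast
      ring
    rw [h1]
    exact ((tendsto_const_nhds.add hlim).rpow_const (Or.inl (by positivity))).const_mul a

theorem ofReal_regularizedSum {a : ℕ → ℝ} (ha : ∀ i, 0 ≤ a i)
    (y : ℕ → EuclideanSpace ℝ (Fin n)) (N : ℕ) (x : EuclideanSpace ℝ (Fin n)) :
    ENNReal.ofReal (regularizedSum p a y N x) = ∑ i ∈ Finset.range N, ENNReal.ofReal
      (a i * (‖x - y i‖ ^ 2 + 1 / ((N : ℝ) + 1)) ^ (-(((n : ℝ) - p) / (p - 1) / 2))) :=
  ENNReal.ofReal_sum_of_nonneg fun i _ => mul_nonneg (ha i) (by positivity)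

theorem regularizedSum_nonneg {a : ℕ → ℝ} (ha : ∀ i, 0 ≤ a i)
    (y : ℕ → EuclideanSpace ℝ (Fin n)) (N : ℕ) (x : EuclideanSpace ℝ (Fin n)) :
    0 ≤ regularizedSum p a y N x :=
  Finset.sum_nonneg fun i _ => mul_nonneg (ha i) (by positivity)

theorem ofReal_regularizedSum_le (hp : 2 ≤ p) (hpn : p < n) {a : ℕ → ℝ}
    (ha : ∀ i, 0 ≤ a i) (y : ℕ → EuclideanSpace ℝ (Fin n)) (N : ℕ)
    (x : EuclideanSpace ℝ (Fin n)) :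
    ENNReal.ofReal (regularizedSum p a y N x) ≤ fundamentalSeries p a y x := by
  rw [ofReal_regularizedSum ha]
  exact (Finset.sum_le_sum fun i _ => ofReal_mul_rpow_le (ha i) (norm_nonneg _) (by positivity)
    (div_pos (by linarith) (by linarith))).trans (ENNReal.sum_le_tsum _)

theorem exists_lt_regularizedSum (hp : 2 ≤ p) (hpn : p < n) {a : ℕ → ℝ}
    (ha : ∀ i, 0 ≤ a i) (y : ℕ → EuclideanSpace ℝ (Fin n)) (x : EuclideanSpace ℝ (Fin n))
    {c : ℝ} (hc : ENNReal.ofReal c < fundamentalSeries p a y x) :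
    ∃ N, c < regularizedSum p a y N x := by
  rw [fundamentalSeries, ENNReal.tsum_eq_iSup_nat, lt_iSup_iff] at hc
  obtain ⟨M, hM⟩ := hc
  have hlim := tendsto_finsetSum (Finset.range M) fun i _ => tendsto_ofReal_mul_rpow (ha i)
    (norm_nonneg (x - y i)) (div_pos (by linarith) (by linarith) : 0 < ((n : ℝ) - p) / (p - 1))
  -- A finite partial sum of `M` terms already exceeds `c`. Its regularization still does for large
  -- `N`, and `N ≥ M` ensures that all its terms occur in the regularized sum.
  obtain ⟨N, hN, hMN⟩ := ((hlim.eventually (lt_mem_nhds hM)).and (eventually_ge_atTop M)).exists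
  refine ⟨N, lt_of_not_ge fun hle => (hN.trans_le ?_).not_ge (ENNReal.ofReal_le_ofReal hle)⟩
  rw [ofReal_regularizedSum ha]
  exact Finset.sum_le_sum_of_subset (Finset.range_mono hMN)

end Series

/-! ### Semicontinuity and the comparison principle for the full sum. -/

section Superharmonic

variable {n : ℕ} {p : ℝ}

theorem coe_regularizedSum_add_le (hp : 2 ≤ p) (hpn : p < n) {a : ℕ → ℝ} (ha : ∀ i, 0 ≤ a i)
    (y : ℕ → EuclideanSpace ℝ (Fin n)) (N : ℕ) (x : EuclideanSpace ℝ (Fin n)) (b : ℝ) :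
    ((regularizedSum p a y N x + b : ℝ) : EReal) ≤ (fundamentalSeries p a y x : EReal) + b := by
  rw [EReal.coe_add]
  gcongr
  have h := EReal.coe_ennreal_le_coe_ennreal_iff.2 (ofReal_regularizedSum_le hp hpn ha y N x)
  rwa [EReal.coe_ennreal_ofReal, max_eq_left (regularizedSum_nonneg ha y N x)] at h

theorem exists_lt_regularizedSum_add (hp : 2 ≤ p) (hpn : p < n) {a : ℕ → ℝ} (ha : ∀ i, 0 ≤ a i)
    (y : ℕ → EuclideanSpace ℝ (Fin n)) (x : EuclideanSpace ℝ (Fin n)) {b c : ℝ}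
    (hc : (c : EReal) < (fundamentalSeries p a y x : EReal) + b) :
    ∃ N, c < regularizedSum p a y N x + b := by
  -- `ENNReal.ofReal` truncates negative numbers, so `c < b` is treated apart; there nonnegativity
  -- of the sums suffices.
  rcases lt_or_ge (c - b) 0 with h | h
  · exact ⟨0, by linarith [regularizedSum_nonneg (p := p) ha y 0 x]⟩
  · have h1 : ((c - b : ℝ) : EReal) < (fundamentalSeries p a y x : EReal) := by
      rw [EReal.coe_sub]
      exact EReal.sub_lt_of_lt_add hc
    rw [← max_eq_left h, ← EReal.coe_ennreal_ofReal, EReal.coe_ennreal_lt_coe_ennreal_iff] at h1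
    obtain ⟨N, hN⟩ := exists_lt_regularizedSum hp hpn ha y x h1
    exact ⟨N, by linarith⟩

/-- The function is the pointwise supremum of the continuous functions `regularizedSum p a y N + K`.
-/
theorem lowerSemicontinuous_fundamentalSeries_add (hp : 2 ≤ p) (hpn : p < n) {a : ℕ → ℝ}
    (ha : ∀ i, 0 ≤ a i) (y : ℕ → EuclideanSpace ℝ (Fin n)) {K : EuclideanSpace ℝ (Fin n) → ℝ}
    (hK : Continuous K) :
    LowerSemicontinuous fun x => (fundamentalSeries p a y x : EReal) + (K x : EReal) := by
  intro x c hc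
  obtain ⟨c', hcc', hc'⟩ := EReal.lt_iff_exists_real_btwn.1 hc
  obtain ⟨N, hN⟩ := exists_lt_regularizedSum_add hp hpn ha y x hc'
  have hcont : Continuous fun z => regularizedSum p a y N z + K z :=
    (isSmoothDominative_regularizedSum hp hpn ha y N).1.continuous.add hK
  filter_upwards [hcont.continuousAt.eventually (lt_mem_nhds hN)] with z hz
  exact (hcc'.trans (EReal.coe_lt_coe_iff.2 hz)).trans_le
    (coe_regularizedSum_add_le hp hpn ha y N z (K z))

/-- If a function continuous on a compact set lies strictly below the sum of the series and a
continuous function, it lies below a regularized partial sum. -/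
theorem exists_forall_lt_regularizedSum_add (hp : 2 ≤ p) (hpn : p < n) {a : ℕ → ℝ}
    (ha : ∀ i, 0 ≤ a i) (y : ℕ → EuclideanSpace ℝ (Fin n))
    {h l : EuclideanSpace ℝ (Fin n) → ℝ} {C : Set (EuclideanSpace ℝ (Fin n))} (hC : IsCompact C)
    (hh : ContinuousOn h C) (hl : Continuous l)
    (hlt : ∀ x ∈ C, (h x : EReal) < (fundamentalSeries p a y x : EReal) + (l x : EReal)) :
    ∃ N, ∀ x ∈ C, h x < regularizedSum p a y N x + l x := by
  -- A Dini-type argument: an index works near each point, and monotonicity in `N` lets the larger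
  -- index serve a union.
  refine hC.induction_on (p := fun s => ∃ N, ∀ x ∈ s, h x < regularizedSum p a y N x + l x)
    ⟨0, by simp⟩ ?_ ?_ ?_
  · rintro s t hst ⟨N, hN⟩
    exact ⟨N, fun x hx => hN x (hst hx)⟩
  · rintro s t ⟨N, hN⟩ ⟨M, hM⟩
    refine ⟨max N M, fun x hx => ?_⟩
    have h1 := monotone_regularizedSum hp hpn ha y x (le_max_left N M)
    have h2 := monotone_regularizedSum hp hpn ha y x (le_max_right N M)
    simp only at h1 h2
    rcases hx with hx | hx
    · linarith [hN x hx]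
    · linarith [hM x hx]
  · intro x hx
    obtain ⟨N, hN⟩ := exists_lt_regularizedSum_add hp hpn ha y x (hlt x hx)
    have hcont : ContinuousOn (fun z => regularizedSum p a y N z + l z) C :=
      ((isSmoothDominative_regularizedSum hp hpn ha y N).1.continuous.add hl).continuousOn
    exact ⟨{z | h z < regularizedSum p a y N z + l z},
      (hh x hx).eventually_lt (hcont x hx) hN, N, fun z hz => hz⟩

/-- A concave function on Euclidean space has affine majorants that are almost sharp at a given
point. -/
theorem ConcaveOn.exists_affine_ge {K : EuclideanSpace ℝ (Fin n) → ℝ}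
    (hK : ConcaveOn ℝ univ K) (hKc : Continuous K) (x : EuclideanSpace ℝ (Fin n)) {η : ℝ}
    (hη : 0 < η) : ∃ (l : EuclideanSpace ℝ (Fin n) →L[ℝ] ℝ) (b : ℝ),
      (∀ z, K z ≤ l z + b) ∧ l x + b = K x + η := by
  -- The convex function `-K` has an affine minorant taking the value `-K x - η`, strictly below `-K
  -- x`, at the point `x`.
  obtain ⟨l, b, h1, h2⟩ := hK.neg.exists_affine_le_of_lt (𝕜 := ℝ) (mem_univ x)
    (a := -K x - η) (by simpa using hη) isClosed_univ
    (hKc.neg.lowerSemicontinuous.lowerSemicontinuousOn _)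
  refine ⟨-l, -b, fun z => ?_, ?_⟩
  · have h3 := h1 ⟨z, mem_univ z⟩
    simp at h3
    simp
    linarith
  · simp at h2
    simp
    linarith

/-- Comparison is available only against smooth dominative functions, so both the series and `K` are
replaced by such functions, with an error at `x` smaller than the supposed excess of `h`. -/
theorem IsPHarmonic.le_fundamentalSeries_add (hp : 2 ≤ p) (hpn : p < n) {a : ℕ → ℝ}
    (ha : ∀ i, 0 ≤ a i) (y : ℕ → EuclideanSpace ℝ (Fin n)) {K : EuclideanSpace ℝ (Fin n) → ℝ}
    (hK : ConcaveOn ℝ univ K) (hKc : Continuous K) {D : Set (EuclideanSpace ℝ (Fin n))}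
    (hD : IsOpen D) (hDb : Bornology.IsBounded D) {h : EuclideanSpace ℝ (Fin n) → ℝ}
    (hc : ContinuousOn h (closure D)) (hh : IsPHarmonic p D h)
    (hle : ∀ x ∈ frontier D, (h x : EReal) ≤ (fundamentalSeries p a y x : EReal) + (K x : EReal))
    {x : EuclideanSpace ℝ (Fin n)} (hx : x ∈ D) :
    (h x : EReal) ≤ (fundamentalSeries p a y x : EReal) + (K x : EReal) := by
  by_contra! hlt
  obtain ⟨w, hw, hwh⟩ := EReal.lt_iff_exists_real_btwn.1 hlt
  rw [EReal.coe_lt_coe_iff] at hwh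
  -- The excess over `w` is spent twice: one `η` on the affine majorant of `K` at `x`, another on
  -- making the inequality on `∂D` strict, as compactness requires.
  set η := (h x - w) / 2 with hη
  have hη0 : 0 < η := by linarith
  obtain ⟨l, b, hl, hlx⟩ := hK.exists_affine_ge hKc x hη0
  have hfc : IsCompact (frontier D) :=
    hDb.isCompact_closure.of_isClosed_subset isClosed_frontier frontier_subset_closure
  obtain ⟨N, hN⟩ := exists_forall_lt_regularizedSum_add hp hpn ha y hfc
    (h := h) (l := fun z => l z + (b + η)) (hc.mono frontier_subset_closure)
    (l.continuous.add continuous_const) fun z hz => by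
      rcases eq_or_ne (fundamentalSeries p a y z) ⊤ with h1 | h1
      · rw [h1]
        exact EReal.coe_lt_top _
      · obtain ⟨s, hs⟩ : ∃ s : ℝ, (fundamentalSeries p a y z : EReal) = s :=
          ⟨_, (EReal.coe_toReal (by simpa using h1) (by simp)).symm⟩
        have h2 := hle z hz
        rw [hs, ← EReal.coe_add, EReal.coe_le_coe_iff] at h2
        rw [hs, ← EReal.coe_add, EReal.coe_lt_coe_iff]
        linarith [hl z]
  have hn : 0 < n := by
    have : (0 : ℝ) < n := by linarith
    exact_mod_cast this
  have h1 := hh.le_of_isSmoothDominative hn hp hD hDb hc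
    ((isSmoothDominative_regularizedSum hp hpn ha y N).add (isSmoothDominative_affine l (b + η)))
    (fun z hz => (hN z hz).le) x hx
  have h2 := (coe_regularizedSum_add_le hp hpn ha y N x (K x)).trans_lt hw
  rw [EReal.coe_lt_coe_iff] at h2
  linarith

end Superharmonic

theorem theorem1 (n : ℕ) (p : ℝ) (hp : 2 ≤ p) (hpn : p < n)
    (a : ℕ → ℝ) (ha : ∀ i, 0 ≤ a i) (y : ℕ → EuclideanSpace ℝ (Fin n))
    (K : EuclideanSpace ℝ (Fin n) → ℝ) (hK : ConcaveOn ℝ Set.univ K)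
    (hconv : ∃ x₀ : EuclideanSpace ℝ (Fin n), fundamentalSeries p a y x₀ ≠ ⊤) :
    IsPSuperharmonic p Set.univ
      (fun x => (fundamentalSeries p a y x : EReal) + (K x : EReal)) := by
  have hKc : Continuous K := by
    have h := (hK.neg.continuousOn isOpen_univ).neg
    rw [neg_neg] at h
    exact continuousOn_univ.1 h
  obtain ⟨x₀, hx₀⟩ := hconv
  refine ⟨fun x _ => ?_, ⟨x₀, mem_univ _, ?_⟩,
    (lowerSemicontinuous_fundamentalSeries_add hp hpn ha y hKc).lowerSemicontinuousOn _,
    fun D hD hDb _ h hc hh hle x hx =>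
      hh.le_fundamentalSeries_add hp hpn ha y hK hKc hD hDb hc hle hx⟩
  · simp [EReal.add_eq_bot_iff]
  · exact EReal.add_ne_top (by simpa using hx₀) (EReal.coe_ne_top _)
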